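/- Let $VB_n$ be the virtual braid group on $n$ strands: generators $\sigma_1,\dots,\sigma_{n-1},\rho_1,\dots,\rho_{n-1}$; relations $\sigma_i\sigma_{i+1}\sigma_i=\sigma_{i+1}\sigma_i\sigma_{i+1}$, $\sigma_i\sigma_j=\sigma_j\sigma_i$ ($|i-j|>1$), $\rho_i^2=1$, $\rho_i\rho_{i+1}\rho_i=\rho_{i+1}\rho_i\rho_{i+1}$, $\rho_i\rho_j=\rho_j\rho_i$ ($|i-j|>1$), $\sigma_i\rho_j=\rho_j\sigma_i$ ($|i-j|>1$), $\rho_i\rho_{i+1}\sigma_i=\sigma_{i+1}\rho_i\rho_{i+1}$. Let $VP_n$, the virtual pure braid group, be the kernel of the homomorphism $VB_n\to S_n$ sending both $\sigma_i$ and $\rho_i$ to the transposition $(i\;i+1)$. In $VP_n$ put $\lambda_{i,i+1}=\rho_i\sigma_i^{-1}$, $\lambda_{i+1,i}=\sigma_i^{-1}\rho_i$ and, for $i<j-1$, $\lambda_{i,j}=\rho_{j-1}\cdots\rho_{i+1}\,\lambda_{i,i+1}\,\rho_{i+1}\cdots\rho_{j-1}$ and $\lambda_{j,i}=\rho_{j-1}\cdots\rho_{i+1}\,\lambda_{i+1,i}\,\rho_{i+1}\cdots\rho_{j-1}$.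 Let $\mathcal R^V(n)$ be the set of relations $$\lambda_{ij}\lambda_{kl}=\lambda_{kl}\lambda_{ij},\qquad \lambda_{ki}\lambda_{kj}\lambda_{ij}=\lambda_{ij}\lambda_{kj}\lambda_{ki}$$ between words in the letters $\lambda_{ij}$, $1\le i\ne j\le n$, where distinct letters stand for distinct indices in $\{1,\dots,n\}$. For $0\le t\le n-1$ the degeneracy $s_t$ (doubling of the $(t+1)$-st strand) replaces the letters $\lambda_{k,l}$, $\lambda_{l,k}$ ($1\le k<l\le n$) by the following words in the letters $\lambda_{ij}$, $1\le i\neq j\le n+1$, where $y^x=x^{-1}yx$: $$s_t(\lambda_{k,l})=\begin{cases}\lambda_{k+1,l+1}& t<k-1,\\ \lambda_{k,l+1}\lambda_{k+1,l+1}& t=k-1,\\ \lambda_{k,l+1}& k-1<t<l-1,\\ \lambda_{k,l+1}^{\lambda_{1,l}\lambda_{2,l}\cdots\lambda_{k-1,l}}\,\lambda_{k,l}& t=l-1,\\ \lambda_{k,l}& t>l-1,\end{cases}$$ $$s_t(\lambda_{l,k})=\begin{cases}\lambda_{l+1,k+1}& t<k-1,\\ \lambda_{l+1,k+1}\lambda_{l+1,k}&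 t=k-1,\\ \lambda_{l+1,k}& k-1<t<l-1,\\ \lambda_{l,k}\,\lambda_{l+1,k}^{\lambda_{l,1}^{-1}\lambda_{l,2}^{-1}\cdots\lambda_{l,k-1}^{-1}}& t=l-1,\\ \lambda_{l,k}& t>l-1.\end{cases}$$ **Theorem.** Let $n\ge 4$. Adding a trivial last strand ($\sigma_i\mapsto\sigma_i$, $\rho_i\mapsto\rho_i$) induces an injective homomorphism $VP_n\to VP_{n+1}$ with $\lambda_{ij}\mapsto\lambda_{ij}$, by which $VP_n$ is viewed as a subgroup of $VP_{n+1}$; for each $0\le t\le n-1$ the rule above defines a unique homomorphism $s_t\colon VP_n\to VP_{n+1}$; and $$\mathcal R^V(n)\cup\bigcup_{t=0}^{n-1}s_t(\mathcal R^V(n))$$ is a complete set of defining relations for $VP_{n+1}$ on the generators $\lambda_{ij}$, $1\le i\ne j\le n+1$; that is, the group with these generators and relations is isomorphic to $VP_{n+1}$ by the isomorphism sending each letter $\lambda_{ij}$ to the element $\lambda_{ij}$. -/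

import Mathlib

namespace VirtualBraid

/-- Generators of the virtual braid group on `n` strands. Strands are numbered `0, …, n - 1`;
`sigma i` and `rho i` involve the strands `i` and `i + 1`. -/
inductive VBGen (n : ℕ) : Type
  | sigma (i : ℕ) (h : i + 1 < n) : VBGen n
  | rho (i : ℕ) (h : i + 1 < n) : VBGen n

/-- The free generator `σ_i`. -/
def fsigma {n : ℕ} (i : ℕ) (h : i + 1 < n) : FreeGroup (VBGen n) := FreeGroup.of (.sigma i h)

/-- The free generator `ρ_i`. -/
def frho {n : ℕ} (i : ℕ) (h : i + 1 < n) : FreeGroup (VBGen n) := FreeGroup.of (.rho i h)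

/-- Relators `u * v⁻¹` for the defining relations `u = v` of the virtual braid group: those of the
braid group, those of the symmetric group, and the mixed ones. -/
inductive VBRel (n : ℕ) : FreeGroup (VBGen n) → Prop
  | sigma_comm (i j : ℕ) (hi : i + 1 < n) (hj : j + 1 < n) (hij : i + 1 < j) :
      VBRel n (fsigma i hi * fsigma j hj * (fsigma j hj * fsigma i hi)⁻¹)
  | sigma_braid (i : ℕ) (hi : i + 1 < n) (hi' : i + 1 + 1 < n) :
      VBRel n (fsigma i hi * fsigma (i + 1) hi' * fsigma i hi *
        (fsigma (i + 1) hi' * fsigma i hi * fsigma (i + 1) hi')⁻¹)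
  | rho_sq (i : ℕ) (hi : i + 1 < n) : VBRel n (frho i hi * frho i hi)
  | rho_comm (i j : ℕ) (hi : i + 1 < n) (hj : j + 1 < n) (hij : i + 1 < j) :
      VBRel n (frho i hi * frho j hj * (frho j hj * frho i hi)⁻¹)
  | rho_braid (i : ℕ) (hi : i + 1 < n) (hi' : i + 1 + 1 < n) :
      VBRel n (frho i hi * frho (i + 1) hi' * frho i hi *
        (frho (i + 1) hi' * frho i hi * frho (i + 1) hi')⁻¹)
  | mixed_comm (i j : ℕ) (hi : i + 1 < n) (hj : j + 1 < n) (hij : i + 1 < j ∨ j + 1 < i) :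
      VBRel n (fsigma i hi * frho j hj * (frho j hj * fsigma i hi)⁻¹)
  | mixed (i : ℕ) (hi : i + 1 < n) (hi' : i + 1 + 1 < n) :
      VBRel n (frho i hi * frho (i + 1) hi' * fsigma i hi *
        (fsigma (i + 1) hi' * frho i hi * frho (i + 1) hi')⁻¹)

/-- The virtual braid group on `n` strands. -/
abbrev VB (n : ℕ) : Type := PresentedGroup {r : FreeGroup (VBGen n) | VBRel n r}

/-- `σ_i` in the virtual braid group. -/
def sigma {n : ℕ} (i : ℕ) (h : i + 1 < n) : VB n := PresentedGroup.of (.sigma i h)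

/-- `ρ_i` in the virtual braid group. -/
def rho {n : ℕ} (i : ℕ) (h : i + 1 < n) : VB n := PresentedGroup.of (.rho i h)

/-- The transposition of the strands `i` and `i + 1`. -/
def transp {n : ℕ} (i : ℕ) (h : i + 1 < n) : Equiv.Perm (Fin n) :=
  Equiv.swap ⟨i, by omega⟩ ⟨i + 1, h⟩

/-- `σ_i` and `ρ_i` both map to the transposition of `i` and `i + 1`. -/
def permGen {n : ℕ} : VBGen n → Equiv.Perm (Fin n)
  | .sigma i h => transp i h
  | .rho i h => transp i h

theorem transp_comm {n : ℕ} (i j : ℕ) (hi : i + 1 < n) (hj : j + 1 < n) (hij : i + 1 < j) :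
    transp i hi * transp j hj = transp j hj * transp i hi := by
  ext x
  simp only [transp, Equiv.Perm.mul_apply, Equiv.swap_apply_def]
  grind

theorem transp_braid {n : ℕ} (i : ℕ) (hi : i + 1 < n) (hi' : i + 1 + 1 < n) :
    transp i hi * transp (i + 1) hi' * transp i hi =
      transp (i + 1) hi' * transp i hi * transp (i + 1) hi' := by
  ext x
  simp only [transp, Equiv.Perm.mul_apply, Equiv.swap_apply_def]
  grind

theorem permGen_rel {n : ℕ} : ∀ r ∈ {r : FreeGroup (VBGen n) | VBRel n r},
    FreeGroup.lift permGen r = 1 := by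
  rintro r hr
  cases hr with
  | sigma_comm i j hi hj hij =>
    rw [map_mul, map_inv, mul_inv_eq_one]
    simpa [fsigma, permGen] using transp_comm i j hi hj hij
  | sigma_braid i hi hi' =>
    rw [map_mul, map_inv, mul_inv_eq_one]
    simpa [fsigma, permGen] using transp_braid i hi hi'
  | rho_sq i hi => simp [frho, permGen, transp]
  | rho_comm i j hi hj hij =>
    rw [map_mul, map_inv, mul_inv_eq_one]
    simpa [frho, permGen] using transp_comm i j hi hj hij
  | rho_braid i hi hi' =>
    rw [map_mul, map_inv, mul_inv_eq_one]
    simpa [frho, permGen] using transp_braid i hi hi'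
  | mixed_comm i j hi hj hij =>
    rw [map_mul, map_inv, mul_inv_eq_one]
    rcases hij with hij | hij
    · simpa [fsigma, frho, permGen] using transp_comm i j hi hj hij
    · simpa [fsigma, frho, permGen] using (transp_comm j i hj hi hij).symm
  | mixed i hi hi' =>
    rw [map_mul, map_inv, mul_inv_eq_one]
    simpa [fsigma, frho, permGen] using transp_braid i hi hi'

/-- The canonical epimorphism from the virtual braid group to the symmetric group. -/
def perm (n : ℕ) : VB n →* Equiv.Perm (Fin n) := PresentedGroup.toGroup permGen_rel

/-- The virtual pure braid group on `n` strands. -/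
abbrev VP (n : ℕ) : Subgroup (VB n) := (perm n).ker

/-- Adding a trivial last strand, on generators. -/
def addStrandGen {n : ℕ} : VBGen n → VB (n + 1)
  | .sigma i h => sigma i (by omega)
  | .rho i h => rho i (by omega)

theorem addStrandGen_rel {n : ℕ} : ∀ r ∈ {r : FreeGroup (VBGen n) | VBRel n r},
    FreeGroup.lift addStrandGen r = 1 := by
  rintro r hr
  cases hr with
  | sigma_comm i j hi hj hij =>
    simpa [fsigma, addStrandGen, sigma, rho, PresentedGroup.of] using PresentedGroup.one_of_mem
      (rels := {r | VBRel (n + 1) r}) (.sigma_comm i j (by omega) (by omega) hij)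
  | sigma_braid i hi hi' =>
    simpa [fsigma, addStrandGen, sigma, rho, PresentedGroup.of] using PresentedGroup.one_of_mem
      (rels := {r | VBRel (n + 1) r}) (.sigma_braid i (by omega) (by omega))
  | rho_sq i hi =>
    simpa [frho, addStrandGen, sigma, rho, PresentedGroup.of] using PresentedGroup.one_of_mem
      (rels := {r | VBRel (n + 1) r}) (.rho_sq i (by omega))
  | rho_comm i j hi hj hij =>
    simpa [frho, addStrandGen, sigma, rho, PresentedGroup.of] using PresentedGroup.one_of_mem
      (rels := {r | VBRel (n + 1) r}) (.rho_comm i j (by omega) (by omega) hij)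
  | rho_braid i hi hi' =>
    simpa [frho, addStrandGen, sigma, rho, PresentedGroup.of] using PresentedGroup.one_of_mem
      (rels := {r | VBRel (n + 1) r}) (.rho_braid i (by omega) (by omega))
  | mixed_comm i j hi hj hij =>
    simpa [fsigma, frho, addStrandGen, sigma, rho, PresentedGroup.of] using PresentedGroup.one_of_mem
      (rels := {r | VBRel (n + 1) r}) (.mixed_comm i j (by omega) (by omega) hij)
  | mixed i hi hi' =>
    simpa [fsigma, frho, addStrandGen, sigma, rho, PresentedGroup.of] using PresentedGroup.one_of_mem
      (rels := {r | VBRel (n + 1) r}) (.mixed i (by omega) (by omega))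

/-- Adding a trivial last strand to a virtual braid. -/
def addStrand (n : ℕ) : VB n →* VB (n + 1) := PresentedGroup.toGroup addStrandGen_rel

/-- `lamUp i d` is `λ_{i, i+1+d}`: `λ_{i, i+1} = ρ_i σ_i⁻¹` and
`λ_{i, j} = ρ_{j-1} ⋯ ρ_{i+1} λ_{i, i+1} ρ_{i+1} ⋯ ρ_{j-1}`. -/
def lamUp {n : ℕ} (i : ℕ) : (d : ℕ) → i + d + 1 < n → VB n
  | 0, h => rho i h * (sigma i h)⁻¹
  | d + 1, h => rho (i + d + 1) h * lamUp i d (by omega) * rho (i + d + 1) h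

/-- `lamDown i d` is `λ_{i+1+d, i}`: `λ_{i+1, i} = σ_i⁻¹ ρ_i` and
`λ_{j, i} = ρ_{j-1} ⋯ ρ_{i+1} λ_{i+1, i} ρ_{i+1} ⋯ ρ_{j-1}`. -/
def lamDown {n : ℕ} (i : ℕ) : (d : ℕ) → i + d + 1 < n → VB n
  | 0, h => (sigma i h)⁻¹ * rho i h
  | d + 1, h => rho (i + d + 1) h * lamDown i d (by omega) * rho (i + d + 1) h

/-- Ordered pairs of distinct strands, indexing the elements `λ_{i,j}`. -/
abbrev Gen (n : ℕ) : Type := {p : Fin n × Fin n // p.1 ≠ p.2}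

/-- The element `λ_{i,j}` as a virtual braid. -/
def lamVB {n : ℕ} (g : Gen n) : VB n :=
  if h : g.1.1 < g.1.2 then
    lamUp g.1.1 (g.1.2 - g.1.1 - 1) (by have := g.1.2.2; have : g.1.1.1 < g.1.2.1 := h; omega)
  else
    lamDown g.1.2 (g.1.1 - g.1.2 - 1) (by
      have := g.1.1.2
      have h1 : ¬ g.1.1.1 < g.1.2.1 := h
      have h2 : g.1.1.1 ≠ g.1.2.1 := fun e => g.2 (Fin.ext e)
      omega)

theorem lamUp_mem {n : ℕ} (i : ℕ) : ∀ (d : ℕ) (h : i + d + 1 < n), lamUp i d h ∈ VP n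
  | 0, h => by
    simp [lamUp, MonoidHom.mem_ker, perm, rho, sigma, permGen]
  | d + 1, h => by
    have ih := lamUp_mem i d (n := n) (by omega)
    rw [MonoidHom.mem_ker] at ih ⊢
    rw [lamUp, map_mul, map_mul, ih]
    simp [perm, rho, permGen, transp]

theorem lamDown_mem {n : ℕ} (i : ℕ) : ∀ (d : ℕ) (h : i + d + 1 < n), lamDown i d h ∈ VP n
  | 0, h => by
    simp [lamDown, MonoidHom.mem_ker, perm, rho, sigma, permGen]
  | d + 1, h => by
    have ih := lamDown_mem i d (n := n) (by omega)
    rw [MonoidHom.mem_ker] at ih ⊢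
    rw [lamDown, map_mul, map_mul, ih]
    simp [perm, rho, permGen, transp]

theorem lamVB_mem {n : ℕ} (g : Gen n) : lamVB g ∈ VP n := by
  unfold lamVB
  split_ifs
  · exact lamUp_mem _ _ _
  · exact lamDown_mem _ _ _

/-- The element `λ_{i,j}` of the virtual pure braid group. -/
def lam {n : ℕ} (g : Gen n) : VP n := ⟨lamVB g, lamVB_mem g⟩

/-- The value in the virtual pure braid group of a word in the letters `λ_{i,j}`. -/
def eval (n : ℕ) : FreeGroup (Gen n) →* VP n := FreeGroup.lift lam

/-- The letter `λ_{a,b}` of the free group, for `a ≠ b` (it is `1`, and never used, for `a = b`). -/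
def X {n : ℕ} (a b : Fin n) : FreeGroup (Gen n) :=
  if h : a ≠ b then FreeGroup.of ⟨(a, b), h⟩ else 1

/-- The standard relators of the virtual pure braid group, distinct letters standing for distinct
indices: `λ_{ij} λ_{kl} = λ_{kl} λ_{ij}` and `λ_{ki} λ_{kj} λ_{ij} = λ_{ij} λ_{kj} λ_{ki}`. -/
def RV (n : ℕ) : Set (FreeGroup (Gen n)) :=
  {r | ∃ i j k l : Fin n, i ≠ j ∧ i ≠ k ∧ i ≠ l ∧ j ≠ k ∧ j ≠ l ∧ k ≠ l ∧
      r = X i j * X k l * (X k l * X i j)⁻¹} ∪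
  {r | ∃ i j k : Fin n, i ≠ j ∧ i ≠ k ∧ j ≠ k ∧
      r = X k i * X k j * X i j * (X i j * X k j * X k i)⁻¹}

/-- Words on `n` strands read as words on `n + 1` strands with a trivial last strand. -/
def inclWord (n : ℕ) : FreeGroup (Gen n) →* FreeGroup (Gen (n + 1)) :=
  FreeGroup.lift fun g => X g.1.1.castSucc g.1.2.castSucc

/-- The word `λ_{0,l} λ_{1,l} ⋯ λ_{k-1,l}` (strands numbered from `0`) on `n + 1` strands. -/
def conjUp {n : ℕ} (k l : Fin n) : FreeGroup (Gen (n + 1)) :=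
  (List.ofFn fun j : Fin k.1 => X (⟨j.1, by omega⟩ : Fin (n + 1)) l.castSucc).prod

/-- The word `λ_{l,0}⁻¹ λ_{l,1}⁻¹ ⋯ λ_{l,k-1}⁻¹` (strands numbered from `0`) on `n + 1` strands. -/
def conjDown {n : ℕ} (k l : Fin n) : FreeGroup (Gen (n + 1)) :=
  (List.ofFn fun j : Fin k.1 => (X l.castSucc (⟨j.1, by omega⟩ : Fin (n + 1)))⁻¹).prod

/-- The word `s_t(λ_{k,l})` for `k < l`. The degeneracy `s_t` doubles the strand `t`, strands being
numbered from `0`. -/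
def degUp {n : ℕ} (t k l : Fin n) : FreeGroup (Gen (n + 1)) :=
  if t < k then X k.succ l.succ
  else if t = k then X k.castSucc l.succ * X k.succ l.succ
  else if t < l then X k.castSucc l.succ
  else if t = l then
    ((conjUp k l)⁻¹ * X k.castSucc l.succ * conjUp k l) * X k.castSucc l.castSucc
  else X k.castSucc l.castSucc

/-- The word `s_t(λ_{l,k})` for `k < l`. -/
def degDown {n : ℕ} (t k l : Fin n) : FreeGroup (Gen (n + 1)) :=
  if t < k then X l.succ k.succ
  else if t = k then X l.succ k.succ * X l.succ k.castSucc
  else if t < l then X l.succ k.castSucc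
  else if t = l then
    X l.castSucc k.castSucc * ((conjDown k l)⁻¹ * X l.succ k.castSucc * conjDown k l)
  else X l.castSucc k.castSucc

/-- The degeneracy `s_t` on words in the letters `λ_{i,j}`. -/
def degWord {n : ℕ} (t : Fin n) : FreeGroup (Gen n) →* FreeGroup (Gen (n + 1)) :=
  FreeGroup.lift fun g =>
    if g.1.1 < g.1.2 then degUp t g.1.1 g.1.2 else degDown t g.1.2 g.1.1

/-- The relators of `RV n`, together with their images under all degeneracies. -/
def cablingRels (n : ℕ) : Set (FreeGroup (Gen (n + 1))) :=
  inclWord n '' RV n ∪ ⋃ t : Fin n, degWord t '' RV n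

end VirtualBraid

namespace VirtualBraid

/-! Two facts carry the theorem: the standard relations present `VP n` for every `n`, and for `n ≥
4` the standard relations on `n + 1` strands follow from the cabling relations.

Cabling. Wherever the standard relations hold, the conjugating words in `s_t` act trivially and
`s_t` is plain doubling, `cable`, which preserves these relations (`IsPure.cable`). Conversely, a
doubled relation combines the relation on strand `t` with the same relation on strand `t + 1`, so
either one yields the other by cancellation. A standard relation has at most four indices, hence
omits one of the `n + 1 ≥ 5` strands. Descending induction on an omitted strand, starting at the
last one, where the relations on `n` strands apply, gives all of them (`isPure_of_cable`). The
obstacle is the last degeneracy: the triviality of its conjugating words needs commutations that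
involve the new strand and are not yet known. These are extracted by `commute_of_prod_conj`.

Presentation. Conjugation by `ρ_k` permutes the `λ_{ij}` through their indices (`rho_conj_lamE`), so
each relation need be checked in one position only, where the triple relation is the braid relation
for the `σ_i⁻¹` (`triple_iff_braid`). Every virtual braid is a word in the `λ_{ij}` times a product
of `ρ_i` (`exists_eval_mul_rho`), and the `ρ_i` generate a copy of the symmetric group, so the
`λ_{ij}` generate the kernel. There are no further relations, because the virtual braid group maps
to the semidirect product of the presented group with the symmetric group, each `λ_{ij}` going to
its generator (`toSemi_lamE`). -/

/-- A family `L a b` indexed by ordered pairs of strands satisfies the standard relations of the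
virtual pure braid group. -/
structure IsPure {Q : Type*} [Group Q] {m : ℕ} (L : Fin m → Fin m → Q) : Prop where
  comm : ∀ i j k l : Fin m, i ≠ j → i ≠ k → i ≠ l → j ≠ k → j ≠ l → k ≠ l →
    Commute (L i j) (L k l)
  triple : ∀ i j k : Fin m, i ≠ j → i ≠ k → j ≠ k →
    L k i * L k j * L i j = L i j * L k j * L k i

/-! ### Doubling a strand in families satisfying the standard relations -/

section Cabling

variable {Q : Type*} [Group Q]

/-- Passing from relators to families in an arbitrary group lets one computation serve both for
evaluation in `VP (n + 1)` and for the group presented by the cabling relators. -/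
theorem isPure_iff {m : ℕ} (f : FreeGroup (Gen m) →* Q) :
    (∀ r ∈ RV m, f r = 1) ↔ IsPure fun a b => f (X a b) := by
  constructor
  · intro h
    refine ⟨fun i j k l h1 h2 h3 h4 h5 h6 => ?_, fun i j k h1 h2 h3 => ?_⟩
    · have := h _ (Or.inl ⟨i, j, k, l, h1, h2, h3, h4, h5, h6, rfl⟩)
      rw [map_mul, map_inv, mul_inv_eq_one] at this
      simpa [commute_iff_eq] using this
    · have := h _ (Or.inr ⟨i, j, k, h1, h2, h3, rfl⟩)
      rw [map_mul, map_inv, mul_inv_eq_one] at this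
      simpa using this
  · rintro h r (⟨i, j, k, l, h1, h2, h3, h4, h5, h6, rfl⟩ | ⟨i, j, k, h1, h2, h3, rfl⟩)
    · rw [map_mul, map_inv, mul_inv_eq_one]
      simpa using (h.comm i j k l h1 h2 h3 h4 h5 h6).eq
    · rw [map_mul, map_inv, mul_inv_eq_one]
      simpa using h.triple i j k h1 h2 h3

theorem IsPure.comp {m p : ℕ} {L : Fin m → Fin m → Q} (h : IsPure L) (φ : Fin p → Fin m)
    (hφ : Function.Injective φ) : IsPure fun a b => L (φ a) (φ b) :=
  ⟨fun _ _ _ _ h1 h2 h3 h4 h5 h6 => h.comm _ _ _ _ (hφ.ne h1) (hφ.ne h2) (hφ.ne h3) (hφ.ne h4)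
    (hφ.ne h5) (hφ.ne h6), fun _ _ _ h1 h2 h3 => h.triple _ _ _ (hφ.ne h1) (hφ.ne h2) (hφ.ne h3)⟩

/-- The symmetry `λ_{ij} ↦ λ_{ji}⁻¹` of the standard relations. -/
theorem IsPure.swap_inv {m : ℕ} {L : Fin m → Fin m → Q} (h : IsPure L) :
    IsPure fun a b => (L b a)⁻¹ := by
  refine ⟨fun i j k l h1 h2 h3 h4 h5 h6 => ?_, fun i j k h1 h2 h3 => ?_⟩
  · exact (h.comm j i l k h1.symm h5 h4 h3 h2 h6.symm).inv_inv
  · have := h.triple i k j h2 h1 h3.symm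
    simpa [mul_assoc] using congrArg (·⁻¹) this

/-- The embedding of strands that skips the second of the two parallel strands `t`, `t + 1`. -/
def skip {n : ℕ} (t : Fin n) : Fin n → Fin (n + 1) := t.succ.succAbove

theorem skip_injective {n : ℕ} (t : Fin n) : Function.Injective (skip t) :=
  Fin.succAbove_right_injective

theorem skip_of_lt {n : ℕ} {t a : Fin n} (h : a < t) : skip t a = a.castSucc :=
  Fin.succAbove_of_castSucc_lt _ _ (Fin.lt_def.2 (by have := Fin.lt_def.1 h; simp; omega))

theorem skip_of_gt {n : ℕ} {t a : Fin n} (h : t < a) : skip t a = a.succ :=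
  Fin.succAbove_of_le_castSucc _ _ (Fin.le_def.2 (by have := Fin.lt_def.1 h; simp; omega))

theorem skip_self {n : ℕ} (t : Fin n) : skip t t = t.castSucc := by
  simp [skip]

theorem skip_ne_succ {n : ℕ} (t a : Fin n) : skip t a ≠ t.succ := Fin.succAbove_ne _ _

theorem skip_ne_castSucc {n : ℕ} {t a : Fin n} (h : a ≠ t) : skip t a ≠ t.castSucc := by
  rw [← skip_self t]; exact (skip_injective t).ne h

theorem exists_skip_eq {n : ℕ} {t : Fin n} {a : Fin (n + 1)} (h1 : a ≠ t.castSucc)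
    (h2 : a ≠ t.succ) : ∃ b, b ≠ t ∧ skip t b = a := by
  obtain ⟨b, rfl⟩ := Fin.exists_succAbove_eq h2
  exact ⟨b, fun h => h1 (by rw [h]; exact skip_self t), rfl⟩

/-- The effect on a family `λ_{ij}` of doubling the strand `t`. -/
def cable {n : ℕ} (t : Fin n) (L : Fin (n + 1) → Fin (n + 1) → Q) (a b : Fin n) : Q :=
  if a = t then L t.castSucc (skip t b) * L t.succ (skip t b)
  else if b = t then L (skip t a) t.succ * L (skip t a) t.castSucc
  else L (skip t a) (skip t b)

theorem cable_left {n : ℕ} (t : Fin n) (L : Fin (n + 1) → Fin (n + 1) → Q) (b : Fin n) :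
    cable t L t b = L t.castSucc (skip t b) * L t.succ (skip t b) := if_pos rfl

theorem cable_right {n : ℕ} {t : Fin n} (L : Fin (n + 1) → Fin (n + 1) → Q) {a : Fin n}
    (h : a ≠ t) : cable t L a t = L (skip t a) t.succ * L (skip t a) t.castSucc := by
  simp [cable, h]

theorem cable_of_ne {n : ℕ} {t : Fin n} (L : Fin (n + 1) → Fin (n + 1) → Q) {a b : Fin n}
    (ha : a ≠ t) (hb : b ≠ t) : cable t L a b = L (skip t a) (skip t b) := by
  simp [cable, ha, hb]

section GroupIdentities

variable {a a' b b' c : Q}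

/-- Unprimed letters lie on one of the two parallel strands, primed ones on the other. A primed and
an unprimed letter commute when they have four distinct indices, and this lets the doubled relation
be regrouped into the two single ones. The `of_double_*` lemmas run the same computation backwards
and cancel. -/
theorem double_first (h1 : a * b * c = c * b * a) (h2 : a' * b' * c = c * b' * a')
    (h3 : Commute a' b) (h4 : Commute b' a) : a * a' * (b * b') * c = c * (b * b') * (a * a') := by
  calc a * a' * (b * b') * c = a * (a' * b) * b' * c := by group
    _ = a * b * (a' * b' * c) := by rw [h3.eq]; group
    _ = a * b * c * b' * a' := by rw [h2]; group
    _ = c * b * (a * b') * a' := by rw [h1]; group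
    _ = _ := by rw [← h4.eq]; group

theorem of_double_first (h1 : a * b * c = c * b * a) (h3 : Commute a' b) (h4 : Commute b' a)
    (h : a * a' * (b * b') * c = c * (b * b') * (a * a')) : a' * b' * c = c * b' * a' := by
  have : a * b * (a' * b' * c) = a * b * (c * b' * a') :=
    calc a * b * (a' * b' * c) = a * (b * a') * b' * c := by group
      _ = a * a' * (b * b') * c := by rw [← h3.eq]; group
      _ = c * b * (b' * a) * a' := by rw [h]; group
      _ = c * b * a * b' * a' := by rw [h4.eq]; group
      _ = _ := by rw [← h1]; group
  exact mul_left_cancel this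

theorem of_double_last (h2 : a' * b' * c = c * b' * a') (h3 : Commute a' b) (h4 : Commute b' a)
    (h : a * a' * (b * b') * c = c * (b * b') * (a * a')) : a * b * c = c * b * a := by
  have : a * b * c * (b' * a') = c * b * a * (b' * a') :=
    calc a * b * c * (b' * a') = a * b * (c * b' * a') := by group
      _ = a * (b * a') * b' * c := by rw [← h2]; group
      _ = a * a' * (b * b') * c := by rw [← h3.eq]; group
      _ = c * b * (b' * a) * a' := by rw [h]; group
      _ = _ := by rw [h4.eq]; group
  exact mul_right_cancel this

theorem double_middle (h1 : a * c * b = b * c * a) (h2 : a' * c * b' = b' * c * a')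
    (h3 : Commute a' b) (h4 : Commute a b') : a' * a * c * (b * b') = b * b' * c * (a' * a) := by
  calc a' * a * c * (b * b') = a' * (a * c * b) * b' := by group
    _ = (a' * b) * c * (a * b') := by rw [h1]; group
    _ = b * (a' * c * b') * a := by rw [h3.eq, h4.eq]; group
    _ = _ := by rw [h2]; group

theorem of_double_middle (h1 : a * c * b = b * c * a)
    (h3 : Commute a' b) (h4 : Commute a b') (h : a' * a * c * (b * b') = b * b' * c * (a' * a)) :
    a' * c * b' = b' * c * a' := by
  have : b * (a' * c * b') * a = b * (b' * c * a') * a :=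
    calc b * (a' * c * b') * a = (b * a') * c * (b' * a) := by group
      _ = a' * (b * c * a) * b' := by rw [← h3.eq, ← h4.eq]; group
      _ = a' * a * c * (b * b') := by rw [← h1]; group
      _ = _ := by rw [h]; group
  exact mul_left_cancel (mul_right_cancel this)

end GroupIdentities

/-- A relation avoiding `t` is only relabelled. Otherwise `t` fills exactly one index, and in the
triple relation each of the three possible places calls for its own doubling identity. -/
theorem IsPure.cable {n : ℕ} {L : Fin (n + 1) → Fin (n + 1) → Q} (h : IsPure L) (t : Fin n) :
    IsPure (cable t L) := by
  have hne : ∀ {a b : Fin n}, a ≠ b → skip t a ≠ skip t b := fun h => (skip_injective t).ne h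
  have hs : ∀ a, skip t a ≠ t.succ := skip_ne_succ t
  have hs' : ∀ a, t.succ ≠ skip t a := fun a => (skip_ne_succ t a).symm
  have hc : ∀ {a}, a ≠ t → skip t a ≠ t.castSucc := skip_ne_castSucc
  have hc' : ∀ {a}, a ≠ t → t.castSucc ≠ skip t a := fun h => (skip_ne_castSucc h).symm
  have hcs : t.castSucc ≠ t.succ := (Fin.castSucc_lt_succ).ne
  have hleft : ∀ j k l, j ≠ t → k ≠ t → l ≠ t → j ≠ k → j ≠ l → k ≠ l →
      Commute (VirtualBraid.cable t L t j) (VirtualBraid.cable t L k l) := by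
    intro j k l hj hk hl h1 h2 h3
    rw [cable_left, cable_of_ne _ hk hl]
    exact (h.comm _ _ _ _ (hc' hj) (hc' hk) (hc' hl) (hne h1) (hne h2) (hne h3)).mul_left
      (h.comm _ _ _ _ (hs' _) (hs' _) (hs' _) (hne h1) (hne h2) (hne h3))
  have hright : ∀ j k l, j ≠ t → k ≠ t → l ≠ t → j ≠ k → j ≠ l → k ≠ l →
      Commute (VirtualBraid.cable t L j t) (VirtualBraid.cable t L k l) := by
    intro j k l hj hk hl h1 h2 h3
    rw [cable_right _ hj, cable_of_ne _ hk hl]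
    exact (h.comm _ _ _ _ (hs _) (hne h1) (hne h2) (hs' _) (hs' _) (hne h3)).mul_left
      (h.comm _ _ _ _ (hc hj) (hne h1) (hne h2) (hc' hk) (hc' hl) (hne h3))
  refine ⟨fun i j k l h1 h2 h3 h4 h5 h6 => ?_, fun i j k h1 h2 h3 => ?_⟩
  · by_cases hi : i = t
    · subst hi; exact hleft _ _ _ h1.symm h2.symm h3.symm h4 h5 h6
    by_cases hj : j = t
    · subst hj; exact hright _ _ _ h1 h4.symm h5.symm h2 h3 h6
    by_cases hk : k = t
    · subst hk; exact (hleft _ _ _ h6.symm h2 h4 h3.symm h5.symm h1).symm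
    by_cases hl : l = t
    · subst hl; exact (hright _ _ _ h6 h3 h5 h2.symm h4.symm h1).symm
    rw [cable_of_ne _ hi hj, cable_of_ne _ hk hl]
    exact h.comm _ _ _ _ (hne h1) (hne h2) (hne h3) (hne h4) (hne h5) (hne h6)
  · by_cases hk : k = t
    · subst hk
      rw [cable_left, cable_left, cable_of_ne _ h2 h3]
      exact double_first (h.triple _ _ _ (hne h1) (hc h2) (hc h3))
        (h.triple _ _ _ (hne h1) (hs _) (hs _))
        (h.comm _ _ _ _ (hs' _) hcs.symm (hs' _) (hc h2) (hne h1) (hc' h3))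
        (h.comm _ _ _ _ (hs' _) hcs.symm (hs' _) (hc h3) (hne h1.symm) (hc' h2))
    by_cases hi : i = t
    · subst hi
      rw [cable_left, cable_right _ hk, cable_of_ne _ hk h1.symm]
      exact double_middle (h.triple _ _ _ (hc' h1.symm) (hc' hk) (hne h3))
        (h.triple _ _ _ (hs' _) (hs' _) (hne h3))
        (h.comm _ _ _ _ (hs _) (hc hk) (hne h3.symm) hcs.symm (hs' _) (hc' h1.symm))
        (h.comm _ _ _ _ (hc hk) (hs _) (hne h3.symm) hcs (hc' h1.symm) (hs' _))
    by_cases hj : j = t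
    · subst hj
      rw [cable_right _ hi, cable_right _ hk, cable_of_ne _ hk hi]
      exact (double_first (h.triple _ _ _ (hs _) (hne h2) (hs' _)).symm
        (h.triple _ _ _ (hc h1) (hne h2) (hc' hk)).symm
        (h.comm _ _ _ _ (hc h1) (hne h2) (hs _) (hc' hk) hcs (hs _))
        (h.comm _ _ _ _ (hc hk) (hne h2.symm) (hs _) (hc' hi) hcs (hs _))).symm
    rw [cable_of_ne _ hk hi, cable_of_ne _ hk hj, cable_of_ne _ hi hj]
    exact h.triple _ _ _ (hne h1) (hne h2) (hne h3)

theorem degWord_X {n : ℕ} (t : Fin n) {a b : Fin n} (h : a ≠ b) :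
    degWord t (X a b) = if a < b then degUp t a b else degDown t b a := by
  simp [degWord, X, h]

/-- A homomorphism in which the conjugating words of a degeneracy act trivially turns the
degeneracy into `cable`. -/
theorem map_degWord {n : ℕ} (f : FreeGroup (Gen (n + 1)) →* Q) (t : Fin n)
    (hup : ∀ j k : Fin n, j < k → k < t →
      Commute (f (X k.castSucc t.succ)) (f (X j.castSucc t.castSucc)))
    (hdown : ∀ j k : Fin n, j < k → k < t →
      Commute (f (X t.succ k.castSucc)) (f (X t.castSucc j.castSucc)))
    {a b : Fin n} (hab : a ≠ b) :
    f (degWord t (X a b)) = cable t (fun a b => f (X a b)) a b := by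
  rw [degWord_X t hab]
  rcases lt_or_gt_of_ne hab with h | h
  · rw [if_pos h, degUp]
    rcases lt_trichotomy t a with ha | rfl | ha
    · rw [if_pos ha, cable_of_ne _ ha.ne' (ha.trans h).ne', skip_of_gt ha, skip_of_gt (ha.trans h)]
    · rw [if_neg (lt_irrefl _), if_pos rfl, cable_left, skip_of_gt h, map_mul]
    rw [if_neg ha.not_gt, if_neg ha.ne']
    rcases lt_trichotomy t b with hb | rfl | hb
    · rw [if_pos hb, cable_of_ne _ ha.ne hb.ne', skip_of_lt ha, skip_of_gt hb]
    · rw [if_neg (lt_irrefl _), if_pos rfl, cable_right _ ha.ne, skip_of_lt ha, map_mul, map_mul,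
        map_mul, map_inv]
      have : Commute (f (X a.castSucc t.succ)) (f (conjUp a t)) := by
        rw [conjUp, map_list_prod]
        refine Commute.list_prod_right _ _ fun x hx => ?_
        simp only [List.map_ofFn, List.mem_ofFn, Function.comp_apply] at hx
        obtain ⟨j, rfl⟩ := hx
        exact hup ⟨j, by omega⟩ a (Fin.lt_def.2 j.2) ha
      rw [mul_assoc _ (f (X a.castSucc t.succ)), this.eq, inv_mul_cancel_left]
    · rw [if_neg hb.not_gt, if_neg hb.ne', cable_of_ne _ ha.ne hb.ne, skip_of_lt ha, skip_of_lt hb]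
  · rw [if_neg h.not_gt, degDown]
    rcases lt_trichotomy t b with ha | rfl | ha
    · rw [if_pos ha, cable_of_ne _ (ha.trans h).ne' ha.ne', skip_of_gt ha, skip_of_gt (ha.trans h)]
    · rw [if_neg (lt_irrefl _), if_pos rfl, cable_right _ hab, skip_of_gt h, map_mul]
    rw [if_neg ha.not_gt, if_neg ha.ne']
    rcases lt_trichotomy t a with hb | rfl | hb
    · rw [if_pos hb, cable_of_ne _ hb.ne' ha.ne, skip_of_lt ha, skip_of_gt hb]
    · rw [if_neg (lt_irrefl _), if_pos rfl, cable_left, skip_of_lt ha, map_mul, map_mul,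
        map_mul, map_inv]
      have : Commute (f (X t.succ b.castSucc)) (f (conjDown b t)) := by
        rw [conjDown, map_list_prod]
        refine Commute.list_prod_right _ _ fun x hx => ?_
        simp only [List.map_ofFn, List.mem_ofFn, Function.comp_apply] at hx
        obtain ⟨j, rfl⟩ := hx
        rw [map_inv]
        exact (hdown ⟨j, by omega⟩ b (Fin.lt_def.2 j.2) ha).inv_right
      rw [mul_assoc _ (f (X t.succ b.castSucc)), this.eq, inv_mul_cancel_left]
    · rw [if_neg hb.not_gt, if_neg hb.ne', cable_of_ne _ hb.ne ha.ne, skip_of_lt ha, skip_of_lt hb]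

theorem IsPure.congr {m : ℕ} {L M : Fin m → Fin m → Q} (h : IsPure L)
    (hLM : ∀ a b, a ≠ b → L a b = M a b) : IsPure M := by
  refine ⟨fun i j k l h1 h2 h3 h4 h5 h6 => ?_, fun i j k h1 h2 h3 => ?_⟩
  · rw [← hLM _ _ h1, ← hLM _ _ h6]
    exact h.comm _ _ _ _ h1 h2 h3 h4 h5 h6
  · rw [← hLM _ _ h1, ← hLM _ _ h2.symm, ← hLM _ _ h3.symm]
    exact h.triple _ _ _ h1 h2 h3

/-- The degeneracies respect the standard relations. -/
theorem IsPure.degWord {n : ℕ} {f : FreeGroup (Gen (n + 1)) →* Q}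
    (h : IsPure fun a b => f (X a b)) (t : Fin n) :
    IsPure fun a b => f (degWord t (X a b)) := by
  refine (h.cable t).congr fun a b hab => (map_degWord f t ?_ ?_ hab).symm
  · intro j k hjk hkt
    have hjk := Fin.lt_def.1 hjk
    have hkt := Fin.lt_def.1 hkt
    apply h.comm <;> (rw [Ne, Fin.ext_iff]; simp only [Fin.val_castSucc, Fin.val_succ]; omega)
  · intro j k hjk hkt
    have hjk := Fin.lt_def.1 hjk
    have hkt := Fin.lt_def.1 hkt
    apply h.comm <;> (rw [Ne, Fin.ext_iff]; simp only [Fin.val_castSucc, Fin.val_succ]; omega)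

/-! ### Recovering commutations hidden behind the conjugating words -/

/-- Induction on `j`: once `x` commutes with the earlier `a i`, the conjugate of `x` by the first `j
+ 1` factors is `(a j)⁻¹ * x * a j`, which equals `z j * x * (z j)⁻¹` because `x` commutes with `a j
* z j`. It also commutes with `z j`; hence so does `x`, and then `x` commutes with `a j`. -/
theorem commute_of_prod_conj {x : Q} {a z : ℕ → Q} {k : ℕ}
    (hx : ∀ j < k, Commute x (a j * z j)) (hz : ∀ j < k, ∀ i < k, i ≠ j → Commute (z j) (a i))
    (hzx : ∀ j < k, Commute (z j) ((List.ofFn fun i : Fin k => a i).prod⁻¹ * x *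
      (List.ofFn fun i : Fin k => a i).prod)) :
    ∀ j < k, Commute x (a j) := by
  set P : ℕ → Q := fun i => (List.ofFn fun j : Fin i => a j).prod with hP
  have P_succ : ∀ i, P (i + 1) = P i * a i := fun i => by
    simp only [hP, List.ofFn_succ', List.concat_eq_append, List.prod_append]; simp
  -- `z j` commutes with every `a i` other than `a j`, so factors can be peeled off the right end of
  -- the conjugating product as long as `a j` stays inside.
  have descend : ∀ j < k, ∀ d i, j < i → i + d = k → Commute (z j) ((P i)⁻¹ * x * P i) := by
    intro j hj d
    induction d with
    | zero => rintro i - rfl; exact hzx j hj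
    | succ d ih =>
      intro i hi hd
      have h1 := ih (i + 1) (by omega) (by omega)
      have h2 := hz j hj i (by omega) (by omega)
      have : (P i)⁻¹ * x * P i = a i * ((P (i + 1))⁻¹ * x * P (i + 1)) * (a i)⁻¹ := by
        rw [P_succ]; group
      rw [this]
      exact (h2.mul_right h1).mul_right h2.inv_right
  have key : ∀ j ≤ k, Commute x (P j) ∧ ∀ i < j, Commute x (a i) := by
    intro j
    induction j with
    | zero => intro _; simp [hP]
    | succ j ih =>
      intro hj
      obtain ⟨h1, h2⟩ := ih (by omega)
      have h3 := descend j hj (k - (j + 1)) (j + 1) (by omega) (by omega)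
      have h4 : (P (j + 1))⁻¹ * x * P (j + 1) = z j * x * (z j)⁻¹ := by
        have e1 : (P j)⁻¹ * x * P j = x := by rw [mul_assoc, h1.eq, inv_mul_cancel_left]
        calc (P (j + 1))⁻¹ * x * P (j + 1) = (a j)⁻¹ * ((P j)⁻¹ * x * P j) * a j := by
              rw [P_succ]; group
          _ = (a j)⁻¹ * (x * (a j * z j)) * (z j)⁻¹ := by rw [e1]; group
          _ = _ := by rw [(hx j hj).eq]; group
      rw [h4] at h3
      -- Commuting with its own conjugate of `x`, `z j` commutes with `x`.
      have h5 : Commute x (z j) := by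
        have := h3.eq
        simp only [mul_assoc, mul_right_inj, inv_mul_cancel, mul_one] at this
        rw [← mul_assoc, mul_inv_eq_iff_eq_mul] at this
        exact this.symm
      have h6 : Commute x (a j) := by
        simpa using (hx j hj).mul_right h5.inv_right
      refine ⟨by rw [P_succ]; exact h1.mul_right h6, fun i hi => ?_⟩
      rcases Nat.lt_succ_iff_lt_or_eq.1 hi with hi | rfl
      exacts [h2 i hi, h6]
  exact fun j hj => (key k le_rfl).2 j hj

theorem IsPure.commute_left {n : ℕ} {L : Fin (n + 1) → Fin (n + 1) → Q} {t : Fin n}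
    (h : IsPure (VirtualBraid.cable t L)) {j k l : Fin (n + 1)}
    (hd : [t.castSucc, t.succ, j, k, l].Nodup) :
    Commute (L t.castSucc j * L t.succ j) (L k l) := by
  simp only [List.nodup_cons, List.mem_cons, not_or, List.not_mem_nil] at hd
  obtain ⟨j, hj, rfl⟩ := exists_skip_eq (t := t) (a := j) (by tauto) (by tauto)
  obtain ⟨k, hk, rfl⟩ := exists_skip_eq (t := t) (a := k) (by tauto) (by tauto)
  obtain ⟨l, hl, rfl⟩ := exists_skip_eq (t := t) (a := l) (by tauto) (by tauto)
  rw [← cable_left, ← cable_of_ne L hk hl]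
  apply h.comm <;> grind

theorem IsPure.commute_right {n : ℕ} {L : Fin (n + 1) → Fin (n + 1) → Q} {t : Fin n}
    (h : IsPure (VirtualBraid.cable t L)) {j k l : Fin (n + 1)}
    (hd : [t.castSucc, t.succ, j, k, l].Nodup) :
    Commute (L j t.succ * L j t.castSucc) (L k l) := by
  simp only [List.nodup_cons, List.mem_cons, not_or, List.not_mem_nil] at hd
  obtain ⟨j, hj, rfl⟩ := exists_skip_eq (t := t) (a := j) (by tauto) (by tauto)
  obtain ⟨k, hk, rfl⟩ := exists_skip_eq (t := t) (a := k) (by tauto) (by tauto)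
  obtain ⟨l, hl, rfl⟩ := exists_skip_eq (t := t) (a := l) (by tauto) (by tauto)
  rw [← cable_right L hj, ← cable_of_ne L hk hl]
  apply h.comm <;> grind

theorem IsPure.commute_succ_left {n : ℕ} {L : Fin (n + 1) → Fin (n + 1) → Q} {t : Fin n}
    (h : IsPure (VirtualBraid.cable t L)) {j k l : Fin (n + 1)}
    (hd : [t.castSucc, t.succ, j, k, l].Nodup) (hL : Commute (L t.castSucc j) (L k l)) :
    Commute (L t.succ j) (L k l) := by
  simpa using hL.inv_left.mul_left (h.commute_left hd)

theorem IsPure.commute_succ_right {n : ℕ} {L : Fin (n + 1) → Fin (n + 1) → Q} {t : Fin n}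
    (h : IsPure (VirtualBraid.cable t L)) {j k l : Fin (n + 1)}
    (hd : [t.castSucc, t.succ, j, k, l].Nodup) (hL : Commute (L j t.castSucc) (L k l)) :
    Commute (L j t.succ) (L k l) := by
  simpa using (h.commute_right hd).mul_left hL.inv_left

theorem cable_swap_inv {n : ℕ} (L : Fin (n + 1) → Fin (n + 1) → Q) (t : Fin n) {a b : Fin n}
    (hab : a ≠ b) : cable t (fun a b => (L b a)⁻¹) a b = (cable t L b a)⁻¹ := by
  by_cases ha : a = t
  · subst ha; rw [cable_left, cable_right _ hab.symm, mul_inv_rev]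
  by_cases hb : b = t
  · subst hb; rw [cable_left, cable_right _ ha, mul_inv_rev]
  rw [cable_of_ne _ ha hb, cable_of_ne _ hb ha]

/-- The conjugating words in the degeneracy doubling the last strand act trivially. -/
theorem commute_last_of_cable {m : ℕ} (hm : 2 ≤ m) {L : Fin (m + 3) → Fin (m + 3) → Q}
    (h0 : IsPure fun a b : Fin (m + 2) => L a.castSucc b.castSucc)
    (hc : ∀ t : Fin (m + 2), t.1 < m + 1 → IsPure (cable t L))
    (hlast : ∀ (j k : ℕ) (_ : j < k) (_ : k < m),
      Commute (L ⟨j, by omega⟩ ⟨m, by omega⟩)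
        ((List.ofFn fun i : Fin k => L ⟨i, by omega⟩ ⟨m + 1, by omega⟩).prod⁻¹ *
          L ⟨k, by omega⟩ ⟨m + 2, by omega⟩ *
          (List.ofFn fun i : Fin k => L ⟨i, by omega⟩ ⟨m + 1, by omega⟩).prod))
    (j k : ℕ) (hjk : j < k) (hk : k ≤ m) :
    Commute (L ⟨k, by omega⟩ ⟨m + 2, by omega⟩) (L ⟨j, by omega⟩ ⟨m + 1, by omega⟩) := by
  have hlt : ∀ (k : ℕ) (_ : k < m) (j : ℕ) (_ : j < k),
      Commute (L ⟨k, by omega⟩ ⟨m + 2, by omega⟩) (L ⟨j, by omega⟩ ⟨m + 1, by omega⟩) := by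
    intro k hk j hj
    -- `Fin.ofNat` makes the sequences total on `ℕ`; its wrap-around never occurs for the indices
    -- used.
    let c : ℕ → Fin (m + 3) := Fin.ofNat (m + 3)
    have hcv : ∀ i (h : i < m + 3), c i = ⟨i, h⟩ := fun i h => Fin.ext (Nat.mod_eq_of_lt h)
    have := commute_of_prod_conj (x := L ⟨k, by omega⟩ ⟨m + 2, by omega⟩)
      (a := fun i => L (c i) ⟨m + 1, by omega⟩) (z := fun i => L (c i) ⟨m, by omega⟩) (k := k)
      ?_ ?_ ?_ j hj
    · simpa only [hcv j (by omega)] using this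
    · intro j hj
      simp only [hcv j (by omega)]
      -- Doubling strand `m` is already available, and gives the commutation with the product
      -- `λ_{j,m+1} λ_{j,m}`.
      exact ((hc ⟨m, by omega⟩ (by simp)).commute_right (j := ⟨j, by omega⟩) (k := ⟨k, by omega⟩)
        (l := ⟨m + 2, by omega⟩) (by simp [Fin.ext_iff]; omega)).symm
    · intro j hj i hi hij
      simp only [hcv j (by omega), hcv i (by omega)]
      refine h0.comm ⟨j, by omega⟩ ⟨m, by omega⟩ ⟨i, by omega⟩ ⟨m + 1, by omega⟩ ?_ ?_ ?_ ?_ ?_ ?_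
        <;> (rw [Ne, Fin.mk.injEq]; omega)
    · intro j hj
      have e : (fun i : Fin k => L (c i) ⟨m + 1, by omega⟩) =
          fun i : Fin k => L ⟨i, by omega⟩ ⟨m + 1, by omega⟩ := by
        funext i; rw [hcv i (by omega)]
      rw [e, hcv j (by omega)]
      exact hlast j k hj hk
  rcases hk.lt_or_eq with hk | rfl
  · exact hlt k hk j hjk
  -- There remains `k = m`, which `commute_of_prod_conj` does not reach. Since `m ≥ 2`, strands `p`
  -- and `p + 1` lie below it: doubling `p + 1` carries the first index from `p + 1` to `p + 2`, and
  -- doubling `p` then carries `j` from `p` to `p + 1`.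
  obtain ⟨p, rfl⟩ : ∃ p, k = p + 2 := ⟨k - 2, by omega⟩
  have hstep : ∀ (j : ℕ) (_ : j < p + 1),
      Commute (L ⟨p + 2, by omega⟩ ⟨p + 2 + 2, by omega⟩)
        (L ⟨j, by omega⟩ ⟨p + 2 + 1, by omega⟩) := by
    intro j hj
    exact (hc ⟨p + 1, by omega⟩ (by simp)).commute_succ_left (by simp [Fin.ext_iff]; omega)
      (hlt (p + 1) (by omega) j (by omega))
  rcases (Nat.lt_succ_iff.1 hjk).lt_or_eq with hj | rfl
  · exact hstep j hj
  · exact ((hc ⟨p, by omega⟩ (show p < _ by omega)).commute_succ_left (by simp [Fin.ext_iff]; omega)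
      (hstep p (by omega)).symm).symm

/-! ### Descending induction on an omitted strand -/

/-- If `t + 1` occurs, replacing it by `t` gives a relation omitting `t + 1`, known by `ih`;
cancelling it from the doubled relation leaves the one wanted. If `t + 1` does not occur, `ih`
applies directly. -/
theorem commute_succ_step {n : ℕ} {L : Fin (n + 1) → Fin (n + 1) → Q} {t : Fin n}
    (hc : IsPure (cable t L))
    (ih : ∀ i j k l, [t.succ, i, j, k, l].Nodup → Commute (L i j) (L k l))
    (i j k l : Fin (n + 1)) (hd : [t.castSucc, i, j, k, l].Nodup) : Commute (L i j) (L k l) := by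
  have hcs : t.castSucc ≠ t.succ := (Fin.castSucc_lt_succ).ne
  by_cases ei : i = t.succ
  · subst ei
    exact hc.commute_succ_left hd (ih _ _ _ _ (by clear ih hc; grind))
  by_cases ej : j = t.succ
  · subst ej
    exact hc.commute_succ_right (by clear ih hc; grind) (ih _ _ _ _ (by clear ih hc; grind))
  by_cases ek : k = t.succ
  · subst ek
    exact (hc.commute_succ_left (by clear ih hc; grind)
      (ih _ _ _ _ (by clear ih hc; grind))).symm
  by_cases el : l = t.succ
  · subst el
    exact (hc.commute_succ_right (by clear ih hc; grind)
      (ih _ _ _ _ (by clear ih hc; grind))).symm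
  exact ih _ _ _ _ (by clear ih hc; grind)

/-- The same exchange of `t` for `t + 1`. The cancellation needs commutations on all four of `t`, `t
+ 1` and the two other strands, so it can only follow the full commutation result. -/
theorem triple_succ_step {n : ℕ} {L : Fin (n + 1) → Fin (n + 1) → Q} {t : Fin n}
    (hc : IsPure (cable t L))
    (hcomm : ∀ i j k l, [i, j, k, l].Nodup → Commute (L i j) (L k l))
    (ih : ∀ i j k, [t.succ, i, j, k].Nodup → L k i * L k j * L i j = L i j * L k j * L k i)
    (i j k : Fin (n + 1)) (hd : [t.castSucc, i, j, k].Nodup) :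
    L k i * L k j * L i j = L i j * L k j * L k i := by
  have hcs : t.castSucc ≠ t.succ := (Fin.castSucc_lt_succ).ne
  have hi : i ≠ t.castSucc := by clear ih hc hcomm; grind
  have hj : j ≠ t.castSucc := by clear ih hc hcomm; grind
  have hk : k ≠ t.castSucc := by clear ih hc hcomm; grind
  by_cases ek : k = t.succ
  · subst ek
    obtain ⟨i, it, rfl⟩ := exists_skip_eq hi (by clear ih hc hcomm; grind)
    obtain ⟨j, jt, rfl⟩ := exists_skip_eq hj (by clear ih hc hcomm; grind)
    have := hc.triple i j t (by clear ih hc hcomm; grind) it jt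
    rw [cable_left, cable_left, cable_of_ne _ it jt] at this
    exact of_double_first (ih _ _ _ (by clear ih hc hcomm this; grind))
      (hcomm _ _ _ _ (by clear ih hc hcomm this; grind))
      (hcomm _ _ _ _ (by clear ih hc hcomm this; grind)) this
  by_cases ei : i = t.succ
  · subst ei
    obtain ⟨k, kt, rfl⟩ := exists_skip_eq hk ek
    obtain ⟨j, jt, rfl⟩ := exists_skip_eq hj (by clear ih hc hcomm; grind)
    have := hc.triple t j k jt.symm kt.symm (by clear ih hc hcomm; grind)
    rw [cable_left, cable_right _ kt, cable_of_ne _ kt jt] at this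
    exact of_double_middle (ih _ _ _ (by clear ih hc hcomm this; grind))
      (hcomm _ _ _ _ (by clear ih hc hcomm this; grind))
      (hcomm _ _ _ _ (by clear ih hc hcomm this; grind)) this
  by_cases ej : j = t.succ
  · subst ej
    obtain ⟨k, kt, rfl⟩ := exists_skip_eq hk ek
    obtain ⟨i, it, rfl⟩ := exists_skip_eq hi ei
    have := hc.triple i t k it (by clear ih hc hcomm; grind) kt.symm
    rw [cable_right _ it, cable_right _ kt, cable_of_ne _ kt it] at this
    -- A doubled second index puts strand `t + 1` before `t`, the reverse of a doubled first index,
    -- so the factor to cancel is now the last one.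
    exact (of_double_last (ih _ _ _ (by clear ih hc hcomm this; grind)).symm
      (hcomm _ _ _ _ (by clear ih hc hcomm this; grind))
      (hcomm _ _ _ _ (by clear ih hc hcomm this; grind)) this.symm).symm
  exact ih _ _ _ (by clear ih hc hcomm; grind)

theorem exists_nodup_cons {n : ℕ} {l : List (Fin n)} (h : l.length < n) (hd : l.Nodup) :
    ∃ m, (m :: l).Nodup := by
  have : l.toFinset.card < (Finset.univ : Finset (Fin n)).card := by
    simpa using (List.toFinset_card_le l).trans_lt h
  obtain ⟨m, -, hm⟩ := Finset.exists_mem_notMem_of_card_lt_card this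
  exact ⟨m, by simpa [hd] using hm⟩

theorem isPure_of_cable {n : ℕ} (hn : 4 ≤ n) {L : Fin (n + 1) → Fin (n + 1) → Q}
    (h0 : IsPure fun a b : Fin n => L a.castSucc b.castSucc)
    (hc : ∀ t : Fin n, IsPure (cable t L)) : IsPure L := by
  have hlast : ∀ a : Fin (n + 1), Fin.last n ≠ a → ∃ b : Fin n, b.castSucc = a := fun a ha =>
    Fin.exists_castSucc_eq.2 ha.symm
  have hcomm : ∀ m i j k l : Fin (n + 1), [m, i, j, k, l].Nodup → Commute (L i j) (L k l) := by
    intro m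
    induction m using Fin.reverseInduction with
    | last =>
      intro i j k l hd
      simp only [List.nodup_cons, List.mem_cons, not_or, List.not_mem_nil] at hd
      obtain ⟨⟨hi, hj, hk, hl, -⟩, hd⟩ := hd
      obtain ⟨i, rfl⟩ := hlast i hi
      obtain ⟨j, rfl⟩ := hlast j hj
      obtain ⟨k, rfl⟩ := hlast k hk
      obtain ⟨l, rfl⟩ := hlast l hl
      simp only [Fin.castSucc_inj] at hd
      apply h0.comm <;> tauto
    | cast t ih => exact commute_succ_step (hc t) ih
  have hcomm : ∀ i j k l : Fin (n + 1), [i, j, k, l].Nodup → Commute (L i j) (L k l) := by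
    intro i j k l hd
    -- Four indices leave a strand free because `n + 1 ≥ 5`; this is where `n ≥ 4` enters.
    obtain ⟨m, hm⟩ := exists_nodup_cons (by simp; omega) hd
    exact hcomm m i j k l hm
  have htriple : ∀ m i j k : Fin (n + 1), [m, i, j, k].Nodup →
      L k i * L k j * L i j = L i j * L k j * L k i := by
    intro m
    induction m using Fin.reverseInduction with
    | last =>
      intro i j k hd
      simp only [List.nodup_cons, List.mem_cons, not_or, List.not_mem_nil] at hd
      obtain ⟨⟨hi, hj, hk, -⟩, hd⟩ := hd
      obtain ⟨i, rfl⟩ := hlast i hi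
      obtain ⟨j, rfl⟩ := hlast j hj
      obtain ⟨k, rfl⟩ := hlast k hk
      simp only [Fin.castSucc_inj] at hd
      apply h0.triple <;> tauto
    | cast t ih => exact triple_succ_step (hc t) hcomm ih
  refine ⟨fun i j k l h1 h2 h3 h4 h5 h6 => hcomm i j k l (by simp; tauto),
    fun i j k h1 h2 h3 => ?_⟩
  obtain ⟨m, hm⟩ := exists_nodup_cons (l := [i, j, k]) (by simp; omega) (by simp; tauto)
  exact htriple m i j k hm

/-- It suffices to remove the conjugating words from the degeneracies, which turns them into `cable`
and brings the situation under `isPure_of_cable`. -/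
theorem isPure_of_degWord {n : ℕ} (hn : 4 ≤ n) (f : FreeGroup (Gen (n + 1)) →* Q)
    (h0 : IsPure fun a b : Fin n => f (X a.castSucc b.castSucc))
    (hd : ∀ t : Fin n, IsPure fun a b => f (degWord t (X a b))) :
    IsPure fun a b => f (X a b) := by
  obtain ⟨m, rfl⟩ : ∃ m, n = m + 2 := ⟨n - 2, by omega⟩
  -- For every degeneracy but the last, the conjugating words involve strands up to `t + 1 ≤ m + 1`
  -- only, so the relations on `n` strands make them trivial.
  have hlt : ∀ t : Fin (m + 2), t.1 < m + 1 → IsPure (cable t fun a b => f (X a b)) := by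
    intro t ht
    refine (hd t).congr fun a b hab => map_degWord f t ?_ ?_ hab
    · intro j k hjk hkt
      have hjk := Fin.lt_def.1 hjk
      have hkt := Fin.lt_def.1 hkt
      apply h0.comm k ⟨t + 1, by omega⟩ j t <;>
        (simp only [Ne, Fin.ext_iff]; omega)
    · intro j k hjk hkt
      have hjk := Fin.lt_def.1 hjk
      have hkt := Fin.lt_def.1 hkt
      apply h0.comm ⟨t + 1, by omega⟩ k t j <;>
        (simp only [Ne, Fin.ext_iff]; omega)
  -- Apply the last degeneracy to `[λ_{j,m}, λ_{k,m+1}] = 1`. The first letter is unchanged and the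
  -- second becomes a conjugate of `λ_{k,m+2}` times `λ_{k,m+1}`; the latter factor commutes with
  -- `λ_{j,m}` by `h0` and drops out.
  have hup := commute_last_of_cable (by omega) h0 hlt (by
    intro j k hjk hk
    have h1 := (hd (Fin.last _)).comm ⟨j, by omega⟩ ⟨m, by omega⟩ ⟨k, by omega⟩ (Fin.last _)
      (by simp [Fin.ext_iff]; omega) (by simp [Fin.ext_iff]; omega) (by simp [Fin.ext_iff]; omega)
      (by simp [Fin.ext_iff]; omega) (by simp [Fin.ext_iff]) (by simp [Fin.ext_iff]; omega)
    have h2 := h0.comm ⟨j, by omega⟩ ⟨m, by omega⟩ ⟨k, by omega⟩ (Fin.last _)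
      (by simp [Fin.ext_iff]; omega) (by simp [Fin.ext_iff]; omega) (by simp [Fin.ext_iff]; omega)
      (by simp [Fin.ext_iff]; omega) (by simp [Fin.ext_iff]) (by simp [Fin.ext_iff]; omega)
    have hkm : (⟨k, by omega⟩ : Fin (m + 2)) < Fin.last _ := Fin.lt_def.2 (by simp; omega)
    have hmm : (⟨m, by omega⟩ : Fin (m + 2)) < Fin.last _ := Fin.lt_def.2 (by simp)
    have hjm : (⟨j, by omega⟩ : Fin (m + 2)) < ⟨m, by omega⟩ := Fin.lt_def.2 (by simp; omega)
    have hjl := hjm.trans hmm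
    rw [degWord_X _ hkm.ne, if_pos hkm, degWord_X _ hjm.ne, if_pos hjm, degUp, degUp,
      if_neg hkm.not_gt, if_neg hkm.ne', if_neg (lt_irrefl _), if_pos rfl, if_neg hjl.not_gt,
      if_neg hjl.ne', if_neg hmm.not_gt, if_neg hmm.ne', map_mul, map_mul, map_mul, map_inv,
      conjUp, map_list_prod, List.map_ofFn] at h1
    have := h1.mul_right h2.inv_right
    rw [mul_inv_cancel_right] at this
    exact this)
  -- Under `λ_{ij} ↦ λ_{ji}⁻¹` the conjugating word of `degDown` takes the shape of the one in
  -- `degUp`.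
  have hdown := commute_last_of_cable (L := fun a b => (f (X b a))⁻¹) (by omega) h0.swap_inv
    (fun t ht => (hlt t ht).swap_inv.congr fun a b hab => (cable_swap_inv _ t hab).symm) (by
    intro j k hjk hk
    have h1 := (hd (Fin.last _)).comm ⟨m, by omega⟩ ⟨j, by omega⟩ (Fin.last _) ⟨k, by omega⟩
      (by simp [Fin.ext_iff]; omega) (by simp [Fin.ext_iff]) (by simp [Fin.ext_iff]; omega)
      (by simp [Fin.ext_iff]; omega) (by simp [Fin.ext_iff]; omega) (by simp [Fin.ext_iff]; omega)
    have h2 := h0.comm ⟨m, by omega⟩ ⟨j, by omega⟩ (Fin.last _) ⟨k, by omega⟩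
      (by simp [Fin.ext_iff]; omega) (by simp [Fin.ext_iff]) (by simp [Fin.ext_iff]; omega)
      (by simp [Fin.ext_iff]; omega) (by simp [Fin.ext_iff]; omega) (by simp [Fin.ext_iff]; omega)
    have hkm : (⟨k, by omega⟩ : Fin (m + 2)) < Fin.last _ := Fin.lt_def.2 (by simp; omega)
    have hmm : (⟨m, by omega⟩ : Fin (m + 2)) < Fin.last _ := Fin.lt_def.2 (by simp)
    have hjm : (⟨j, by omega⟩ : Fin (m + 2)) < ⟨m, by omega⟩ := Fin.lt_def.2 (by simp; omega)
    have hjl := hjm.trans hmm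
    rw [degWord_X _ hkm.ne', if_neg hkm.not_gt, degWord_X _ hjm.ne', if_neg hjm.not_gt, degDown,
      degDown, if_neg hkm.not_gt, if_neg hkm.ne', if_neg (lt_irrefl _), if_pos rfl,
      if_neg hjl.not_gt, if_neg hjl.ne', if_neg hmm.not_gt, if_neg hmm.ne', map_mul, map_mul,
      map_mul, map_inv, conjDown, map_list_prod, List.map_ofFn] at h1
    have := (h2.inv_right.mul_right h1).inv_inv
    rw [inv_mul_cancel_left, mul_inv_rev, mul_inv_rev, inv_inv, ← mul_assoc] at this
    have e : (⇑f ∘ fun i : Fin k => (X (Fin.last (m + 1)).castSucc ⟨i, by omega⟩)⁻¹) =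
      fun i : Fin k => (f (X (Fin.last (m + 1)).castSucc ⟨i, by omega⟩))⁻¹ := by
      funext i; simp
    rw [e] at this
    exact this)
  refine isPure_of_cable hn h0 fun t => ?_
  rcases (Nat.lt_succ_iff.1 t.2).lt_or_eq with ht | ht
  · exact hlt t ht
  obtain rfl : t = Fin.last _ := Fin.ext ht
  refine (hd _).congr fun a b hab => map_degWord f _ ?_ ?_ hab
  · intro j k hjk hkt
    exact hup j k hjk (by have := Fin.lt_def.1 hkt; simp at this; omega)
  · intro j k hjk hkt
    exact Commute.inv_inv_iff.1
      (hdown j k hjk (by have := Fin.lt_def.1 hkt; simp at this; omega))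

end Cabling

/-! ### Defining relations in the virtual braid group -/

section Relations

variable {n : ℕ}

theorem rho_mul_self (i : ℕ) (hi : i + 1 < n) : rho i hi * rho i hi = 1 := by
  simpa [frho, rho, PresentedGroup.of] using PresentedGroup.one_of_mem
    (rels := {r | VBRel n r}) (.rho_sq i hi)

theorem rho_inv (i : ℕ) (hi : i + 1 < n) : (rho i hi)⁻¹ = rho i hi :=
  inv_eq_of_mul_eq_one_left (rho_mul_self i hi)

theorem rho_comm (i j : ℕ) (hi : i + 1 < n) (hj : j + 1 < n) (hij : i + 1 < j ∨ j + 1 < i) :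
    Commute (rho i hi) (rho j hj) := by
  have key : ∀ (i j : ℕ) (hi : i + 1 < n) (hj : j + 1 < n), i + 1 < j →
      Commute (rho i hi) (rho j hj) := fun i j hi hj hij => mul_inv_eq_one.1 <| by
    simpa [frho, rho, PresentedGroup.of] using PresentedGroup.one_of_mem
      (rels := {r | VBRel n r}) (.rho_comm i j hi hj hij)
  exact hij.elim (key i j hi hj) fun h => (key j i hj hi h).symm

theorem rho_braid (i : ℕ) (hi : i + 1 < n) (hi' : i + 1 + 1 < n) :
    rho i hi * rho (i + 1) hi' * rho i hi = rho (i + 1) hi' * rho i hi * rho (i + 1) hi' :=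
  mul_inv_eq_one.1 <| by
    simpa [frho, rho, PresentedGroup.of] using PresentedGroup.one_of_mem
      (rels := {r | VBRel n r}) (.rho_braid i hi hi')

theorem sigma_comm (i j : ℕ) (hi : i + 1 < n) (hj : j + 1 < n) (hij : i + 1 < j) :
    Commute (sigma i hi) (sigma j hj) :=
  mul_inv_eq_one.1 <| by
    simpa [fsigma, sigma, PresentedGroup.of] using PresentedGroup.one_of_mem
      (rels := {r | VBRel n r}) (.sigma_comm i j hi hj hij)

theorem sigma_braid (i : ℕ) (hi : i + 1 < n) (hi' : i + 1 + 1 < n) :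
    sigma i hi * sigma (i + 1) hi' * sigma i hi =
      sigma (i + 1) hi' * sigma i hi * sigma (i + 1) hi' :=
  mul_inv_eq_one.1 <| by
    simpa [fsigma, sigma, PresentedGroup.of] using PresentedGroup.one_of_mem
      (rels := {r | VBRel n r}) (.sigma_braid i hi hi')

theorem sigma_rho_comm (i j : ℕ) (hi : i + 1 < n) (hj : j + 1 < n) (hij : i + 1 < j ∨ j + 1 < i) :
    Commute (sigma i hi) (rho j hj) :=
  mul_inv_eq_one.1 <| by
    simpa [fsigma, frho, sigma, rho, PresentedGroup.of] using PresentedGroup.one_of_mem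
      (rels := {r | VBRel n r}) (.mixed_comm i j hi hj hij)

theorem rho_rho_sigma (i : ℕ) (hi : i + 1 < n) (hi' : i + 1 + 1 < n) :
    rho i hi * rho (i + 1) hi' * sigma i hi = sigma (i + 1) hi' * rho i hi * rho (i + 1) hi' :=
  mul_inv_eq_one.1 <| by
    simpa [fsigma, frho, sigma, rho, PresentedGroup.of] using PresentedGroup.one_of_mem
      (rels := {r | VBRel n r}) (.mixed i hi hi')

@[simp]
theorem perm_rho (i : ℕ) (hi : i + 1 < n) : perm n (rho i hi) = transp i hi := by
  simp [perm, rho, permGen]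

end Relations

/-! ### Action of the `ρ_k` on the `λ_{ij}` by conjugation -/

section Towers

variable {n : ℕ}

/-- `ρ_{i+d} ⋯ ρ_{i+1} c_i ρ_{i+1} ⋯ ρ_{i+d}`. -/
def tower (c : (i : ℕ) → i + 1 < n → VB n) (i : ℕ) : (d : ℕ) → i + d + 1 < n → VB n
  | 0, h => c i h
  | d + 1, h => rho (i + d + 1) h * tower c i d (by omega) * rho (i + d + 1) h

/-- The properties of `λ_{i,i+1}` and `λ_{i+1,i}` that determine the action of the `ρ_k` on all
`λ_{i,j}`. -/
structure IsTowerBase (c : (i : ℕ) → i + 1 < n → VB n) : Prop where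
  comm : ∀ i k (hi : i + 1 < n) (hk : k + 1 < n), (i + 1 < k ∨ k + 1 < i) →
    Commute (rho k hk) (c i hi)
  shift : ∀ i (hi : i + 1 < n) (hi' : i + 1 + 1 < n),
    rho i hi * rho (i + 1) hi' * c i hi = c (i + 1) hi' * rho i hi * rho (i + 1) hi'

theorem isTowerBase_up : IsTowerBase fun i (h : i + 1 < n) => rho i h * (sigma i h)⁻¹ := by
  refine ⟨fun i k hi hk hik => ?_, fun i hi hi' => ?_⟩
  · exact (rho_comm k i hk hi hik.symm).mul_right (sigma_rho_comm i k hi hk hik).symm.inv_right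
  · have h : rho i hi * rho (i + 1) hi' * (sigma i hi)⁻¹ =
        (sigma (i + 1) hi')⁻¹ * rho i hi * rho (i + 1) hi' := by
      rw [mul_inv_eq_iff_eq_mul, mul_assoc, mul_assoc, eq_inv_mul_iff_mul_eq, ← mul_assoc,
        ← rho_rho_sigma i hi hi', mul_assoc]
    rw [← mul_assoc, rho_braid, mul_assoc, mul_assoc, ← mul_assoc (rho i hi), h]
    simp only [mul_assoc]

theorem isTowerBase_down : IsTowerBase fun i (h : i + 1 < n) => (sigma i h)⁻¹ * rho i h := by
  refine ⟨fun i k hi hk hik => ?_, fun i hi hi' => ?_⟩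
  · exact (sigma_rho_comm i k hi hk hik).symm.inv_right.mul_right (rho_comm k i hk hi hik.symm)
  · have h : rho i hi * rho (i + 1) hi' * (sigma i hi)⁻¹ =
        (sigma (i + 1) hi')⁻¹ * rho i hi * rho (i + 1) hi' := by
      rw [mul_inv_eq_iff_eq_mul, mul_assoc, mul_assoc, eq_inv_mul_iff_mul_eq, ← mul_assoc,
        ← rho_rho_sigma i hi hi', mul_assoc]
    rw [← mul_assoc, h, mul_assoc _ (rho (i + 1) hi'), mul_assoc, ← mul_assoc (rho i hi),
      rho_braid]
    simp only [mul_assoc]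

theorem lamUp_eq_tower (i : ℕ) : ∀ (d : ℕ) (h : i + d + 1 < n),
    lamUp i d h = tower (fun i h => rho i h * (sigma i h)⁻¹) i d h
  | 0, _ => rfl
  | d + 1, h => by rw [lamUp, tower, lamUp_eq_tower i d]

theorem lamDown_eq_tower (i : ℕ) : ∀ (d : ℕ) (h : i + d + 1 < n),
    lamDown i d h = tower (fun i h => (sigma i h)⁻¹ * rho i h) i d h
  | 0, _ => rfl
  | d + 1, h => by rw [lamDown, tower, lamDown_eq_tower i d]

theorem conj_rho_eq_iff {x y : VB n} (k : ℕ) (hk : k + 1 < n) :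
    rho k hk * x * rho k hk = y ↔ rho k hk * x = y * rho k hk := by
  constructor
  · rintro rfl; rw [mul_assoc _ (rho k hk), rho_mul_self, mul_one]
  · intro h; rw [h, mul_assoc, rho_mul_self, mul_one]

variable {c : (i : ℕ) → i + 1 < n → VB n}

theorem IsTowerBase.commute_far (hc : IsTowerBase c) (i k : ℕ) (hk : k + 1 < n) :
    ∀ (d : ℕ) (h : i + d + 1 < n), (k + 1 < i ∨ i + d + 1 < k) →
      Commute (rho k hk) (tower c i d h)
  | 0, h, hik => hc.comm i k h hk (by omega)
  | d + 1, h, hik =>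
    ((rho_comm k _ hk h (by omega)).mul_right
      (hc.commute_far i k hk d (by omega) (by omega))).mul_right (rho_comm k _ hk h (by omega))

/-- Layers of the tower far from `k` commute with `ρ_k`. When `k` is the index of the layer just
below the top one, the braid relation turns `ρ_k` into the top `ρ`, which commutes with the inner
tower, and back again. -/
theorem IsTowerBase.commute_between (hc : IsTowerBase c) (i k : ℕ) (hk : k + 1 < n) (hik : i < k) :
    ∀ (d : ℕ) (h : i + d + 1 < n), k < i + d → Commute (rho k hk) (tower c i d h)
  | 0, h, hkd => by omega
  | d + 1, h, hkd => by
    rcases Nat.lt_or_ge k (i + d) with hlt | hge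
    · exact ((rho_comm k _ hk h (by omega)).mul_right
        (hc.commute_between i k hk hik d (by omega) hlt)).mul_right
        (rho_comm k _ hk h (by omega))
    · obtain ⟨e, rfl⟩ : ∃ e, d = e + 1 := ⟨d - 1, by omega⟩
      obtain rfl : k = i + e + 1 := by omega
      have h1 := rho_braid (i + e + 1) hk h
      have h2 := hc.commute_far i (i + e + 1 + 1) h e (by omega) (by omega)
      rw [commute_iff_eq]
      change rho (i + e + 1) hk * (rho (i + e + 1 + 1) h * (rho (i + e + 1) hk *
        tower c i e (by omega) * rho (i + e + 1) hk) * rho (i + e + 1 + 1) h) =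
        (rho (i + e + 1 + 1) h * (rho (i + e + 1) hk *
        tower c i e (by omega) * rho (i + e + 1) hk) * rho (i + e + 1 + 1) h) * rho (i + e + 1) hk
      generalize rho (i + e + 1) hk = p at *
      generalize rho (i + e + 1 + 1) h = q at *
      generalize tower c i e _ = x at *
      calc p * (q * (p * x * p) * q) = (p * q * p) * x * p * q := by group
        _ = q * p * (q * x) * p * q := by rw [h1]; group
        _ = q * p * x * (q * p * q) := by rw [h2.eq]; group
        _ = _ := by rw [← h1]; group

theorem rho_congr {i j : ℕ} (h : i = j) (hi : i + 1 < n) (hj : j + 1 < n) :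
    rho i hi = rho j hj := by
  subst h; rfl

theorem IsTowerBase.conj_bottom (hc : IsTowerBase c) (i : ℕ) :
    ∀ (d : ℕ) (h : i + (d + 1) + 1 < n),
      rho i (by omega) * tower c i (d + 1) h * rho i (by omega) = tower c (i + 1) d (by omega)
  | 0, h => by
    have := hc.shift i (by omega) h
    change rho i _ * (rho (i + 1) h * c i _ * rho (i + 1) h) * rho i _ = c (i + 1) h
    rw [← mul_assoc, ← mul_assoc, this, mul_assoc _ (rho (i + 1) h) (rho (i + 1) h),
      rho_mul_self, mul_one, mul_assoc, rho_mul_self, mul_one]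
  | d + 1, h => by
    have h1 := rho_comm i (i + (d + 1) + 1) (by omega) h (by omega)
    have ih := hc.conj_bottom i d (by omega)
    change rho i _ * (rho (i + (d + 1) + 1) h * tower c i (d + 1) _ * rho (i + (d + 1) + 1) h) *
      rho i _ = rho (i + 1 + d + 1) _ * tower c (i + 1) d _ * rho (i + 1 + d + 1) _
    rw [← ih, rho_congr (show i + 1 + d + 1 = i + (d + 1) + 1 by omega) _ h]
    simp only [mul_assoc]
    rw [← h1.eq, ← mul_assoc, h1.eq, mul_assoc]

theorem IsTowerBase.conj_top (i d : ℕ) (h : i + (d + 1) + 1 < n) :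
    rho (i + d + 1) h * tower c i (d + 1) h * rho (i + d + 1) h = tower c i d (by omega) := by
  rw [tower]
  simp only [mul_assoc, rho_mul_self, mul_one]
  rw [← mul_assoc, rho_mul_self, one_mul]

end Towers

/-- The element `λ_{a,b}` as a virtual braid, for `a ≠ b`. -/
def lamE {n : ℕ} (a b : Fin n) : VB n := eval n (X a b)

theorem lamE_of_ne {n : ℕ} {a b : Fin n} (h : a ≠ b) : lamE a b = lamVB ⟨(a, b), h⟩ := by
  simp [lamE, eval, X, h, lam]

theorem lamE_up {n : ℕ} (i d : ℕ) (h : i + d + 1 < n) :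
    lamE (⟨i, by omega⟩ : Fin n) ⟨i + d + 1, h⟩ = lamUp i d h := by
  rw [lamE_of_ne (by simp; omega), lamVB, dif_pos (Fin.lt_def.2 (show i < i + d + 1 by omega))]
  congr 1
  simp; omega

theorem lamE_down {n : ℕ} (i d : ℕ) (h : i + d + 1 < n) :
    lamE (⟨i + d + 1, h⟩ : Fin n) ⟨i, by omega⟩ = lamDown i d h := by
  rw [lamE_of_ne (by simp; omega), lamVB, dif_neg (Fin.not_lt.2 (Fin.le_def.2 (show i ≤ i + d + 1 by omega)))]
  congr 1
  simp; omega

theorem transp_of_ne {n : ℕ} {k : ℕ} (hk : k + 1 < n) {a : ℕ} (ha : a < n) (h1 : a ≠ k)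
    (h2 : a ≠ k + 1) : transp k hk ⟨a, ha⟩ = ⟨a, ha⟩ :=
  Equiv.swap_apply_of_ne_of_ne (by simpa using h1) (by simpa using h2)

theorem transp_left {n : ℕ} {k : ℕ} (hk : k + 1 < n) (ha : k < n) :
    transp k hk ⟨k, ha⟩ = ⟨k + 1, hk⟩ := Equiv.swap_apply_left _ _

theorem transp_right {n : ℕ} {k : ℕ} (hk : k + 1 < n) :
    transp k hk ⟨k + 1, hk⟩ = ⟨k, by omega⟩ := Equiv.swap_apply_right _ _

/-- Case analysis on the position of `k` relative to the ends of the tower. The excluded case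
reverses the pair, leaving the given kind of tower. -/
theorem IsTowerBase.rho_conj {n : ℕ} {c : (i : ℕ) → i + 1 < n → VB n} (hc : IsTowerBase c)
    (F : Fin n → Fin n → VB n)
    (hF : ∀ i d (h : i + d + 1 < n), F ⟨i, by omega⟩ ⟨i + d + 1, h⟩ = tower c i d h)
    (k : ℕ) (hk : k + 1 < n) (i d : ℕ) (h : i + d + 1 < n) (hne : ¬ (k = i ∧ d = 0)) :
    rho k hk * F ⟨i, by omega⟩ ⟨i + d + 1, h⟩ * rho k hk =
      F (transp k hk ⟨i, by omega⟩) (transp k hk ⟨i + d + 1, h⟩) := by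
  have hcomm : Commute (rho k hk) (tower c i d h) →
      rho k hk * tower c i d h * rho k hk = tower c i d h := fun h => by
    rw [h.eq, mul_assoc, rho_mul_self, mul_one]
  rcases Nat.lt_trichotomy (k + 1) i with h1 | rfl | h1
  · rw [transp_of_ne hk _ (by omega) (by omega), transp_of_ne hk _ (by omega) (by omega), hF]
    exact hcomm (hc.commute_far i k hk d h (by omega))
  · rw [transp_right, transp_of_ne hk _ (by omega) (by omega), hF, ← hc.conj_bottom]
    have := hF k (d + 1) (by omega)
    have e : (⟨k + 1 + d + 1, h⟩ : Fin n) = ⟨k + (d + 1) + 1, by omega⟩ := Fin.ext (by simp; omega)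
    rw [e, this]
    simp only [mul_assoc, rho_mul_self, mul_one]
    rw [← mul_assoc, rho_mul_self, one_mul]
  rcases Nat.lt_trichotomy k i with h2 | rfl | h2
  · omega
  · obtain ⟨e, rfl⟩ : ∃ e, d = e + 1 := ⟨d - 1, by omega⟩
    rw [transp_left, transp_of_ne hk _ (by omega) (by omega), hF, hc.conj_bottom]
    have := hF (k + 1) e (by omega)
    have e : (⟨k + 1 + e + 1, by omega⟩ : Fin n) = ⟨k + (e + 1) + 1, h⟩ := Fin.ext (by simp; omega)
    rw [← this, e]
  rcases Nat.lt_trichotomy k (i + d) with h3 | rfl | h3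
  · rw [transp_of_ne hk _ (by omega) (by omega), transp_of_ne hk _ (by omega) (by omega), hF]
    exact hcomm (hc.commute_between i k hk h2 d h h3)
  · obtain ⟨e, rfl⟩ : ∃ e, d = e + 1 := ⟨d - 1, by omega⟩
    rw [transp_of_ne hk _ (by omega) (by omega), transp_right, hF]
    exact (IsTowerBase.conj_top i e h).trans (hF i e (by omega)).symm
  rcases Nat.lt_trichotomy k (i + d + 1) with h4 | rfl | h4
  · omega
  · rw [transp_of_ne hk _ (by omega) (by omega), transp_left, hF]
    exact (hF i (d + 1) hk).symm
  · rw [transp_of_ne hk _ (by omega) (by omega), transp_of_ne hk _ (by omega) (by omega), hF]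
    exact hcomm (hc.commute_far i k hk d h (by omega))

/-- Apart from the towers, there remains `ρ_k` acting on its own pair, where `ρ_k (ρ_k σ_k⁻¹) ρ_k =
σ_k⁻¹ ρ_k` exchanges the two base elements. -/
theorem rho_conj_lamE {n : ℕ} (k : ℕ) (hk : k + 1 < n) {a b : Fin n} (hab : a ≠ b) :
    rho k hk * lamE a b * rho k hk = lamE (transp k hk a) (transp k hk b) := by
  obtain ⟨a, ha⟩ := a
  obtain ⟨b, hb⟩ := b
  rcases lt_or_gt_of_ne (show a ≠ b by simpa using hab) with h | h
  · obtain ⟨d, rfl⟩ : ∃ d, b = a + d + 1 := ⟨b - a - 1, by omega⟩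
    by_cases hka : k = a ∧ d = 0
    · obtain ⟨rfl, rfl⟩ := hka
      rw [lamE_up k 0 hk]
      refine Eq.trans ?_ (congrArg₂ lamE (transp_left hk ha) (transp_right hk)).symm
      refine Eq.trans ?_ (lamE_down k 0 hk).symm
      rw [lamUp, lamDown, ← mul_assoc, rho_mul_self, one_mul]
    · exact isTowerBase_up.rho_conj lamE (fun i d h => by rw [lamE_up, lamUp_eq_tower]) k hk a d hb
        hka
  · obtain ⟨d, rfl⟩ : ∃ d, a = b + d + 1 := ⟨a - b - 1, by omega⟩
    by_cases hka : k = b ∧ d = 0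
    · obtain ⟨rfl, rfl⟩ := hka
      rw [lamE_down k 0 hk]
      refine Eq.trans ?_ (congrArg₂ lamE (transp_right hk) (transp_left hk hb)).symm
      refine Eq.trans ?_ (lamE_up k 0 hk).symm
      rw [lamUp, lamDown, mul_assoc, mul_assoc, rho_mul_self, mul_one]
    · exact isTowerBase_down.rho_conj (fun a b => lamE b a)
        (fun i d h => by rw [lamE_down, lamDown_eq_tower]) k hk b d ha hka

/-! ### The symmetric group generated by the `ρ_i` -/

section Coxeter

variable {n : ℕ}

/-- The subgroup generated by the `ρ_i` permuting the first `m` strands. -/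
def rhoSubgroup (n m : ℕ) : Subgroup (VB n) :=
  Subgroup.closure {x | ∃ (i : ℕ) (h : i + 1 < n), i + 1 < m ∧ rho i h = x}

theorem rho_mem {i m : ℕ} (h : i + 1 < n) (hm : i + 1 < m) : rho i h ∈ rhoSubgroup n m :=
  Subgroup.subset_closure ⟨i, h, hm, rfl⟩

@[elab_as_elim]
theorem rhoSubgroup_induction {m : ℕ} {p : (x : VB n) → x ∈ rhoSubgroup n m → Prop}
    (one : p 1 (one_mem _))
    (mul_rho : ∀ x i (h : i + 1 < n) (hx : x ∈ rhoSubgroup n m) (hm : i + 1 < m), p x hx →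
      p (x * rho i h) (mul_mem hx (rho_mem h hm)))
    {x : VB n} (hx : x ∈ rhoSubgroup n m) : p x hx := by
  induction hx using Subgroup.closure_induction_right with
  | one => exact one
  | mul_right x hx y hy ih =>
    obtain ⟨i, h, hm, rfl⟩ := hy
    exact mul_rho x i h hx hm ih
  | mul_inv_cancel x hx y hy ih =>
    obtain ⟨i, h, hm, rfl⟩ := hy
    simp only [rho_inv]
    exact mul_rho x i h hx hm ih

/-- `ρ_i`, or `1` if there is no such generator. -/
def rho' (n i : ℕ) : VB n := if h : i + 1 < n then rho i h else 1

theorem rho'_of_lt {i : ℕ} (h : i + 1 < n) : rho' n i = rho i h := dif_pos h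

theorem rho'_comm {i j : ℕ} (h : i + 1 < j ∨ j + 1 < i) : Commute (rho' n i) (rho' n j) := by
  unfold rho'
  split_ifs with hi hj
  · exact rho_comm i j hi hj h
  all_goals simp

/-- The descending product `ρ_{k+d-1} ⋯ ρ_k`. -/
def descProd (n k : ℕ) : ℕ → VB n
  | 0 => 1
  | d + 1 => rho' n (k + d) * descProd n k d

theorem descProd_succ_right (k : ℕ) : ∀ d, descProd n k (d + 1) = descProd n (k + 1) d * rho' n k
  | 0 => by simp [descProd]
  | d + 1 => by
    rw [descProd, descProd_succ_right k d, ← mul_assoc, descProd]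
    congr 3; omega

theorem descProd_commute {k j : ℕ} : ∀ d, (j + 1 < k ∨ k + d < j) →
    Commute (descProd n k d) (rho' n j)
  | 0, _ => Commute.one_left _
  | d + 1, h => (rho'_comm (by omega)).mul_left (descProd_commute d (by omega))

theorem descProd_mul_rho {k j : ℕ} (hkj : k ≤ j) : ∀ d, j + 1 < k + d → k + d < n →
    descProd n k d * rho' n (j + 1) = rho' n j * descProd n k d
  | 0, h, _ => by omega
  | d + 1, h, hn => by
    rcases Nat.lt_or_ge (j + 1) (k + d) with hlt | hge
    · rw [descProd, mul_assoc, descProd_mul_rho hkj d hlt (by omega), ← mul_assoc, ← mul_assoc,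
        (rho'_comm (n := n) (i := j) (j := k + d) (by omega)).eq]
    · obtain ⟨e, rfl⟩ : ∃ e, d = e + 1 := ⟨d - 1, by omega⟩
      obtain rfl : j = k + e := by omega
      have h1 := rho_braid (k + e) (n := n) (by omega) (by omega)
      rw [← rho'_of_lt, ← rho'_of_lt] at h1
      have h2 := (descProd_commute (n := n) (k := k) (j := k + e + 1) e (by omega)).eq
      rw [descProd, descProd, ← Nat.add_assoc, mul_assoc, mul_assoc, h2]
      simp only [← mul_assoc]
      rw [h1]

/-- The descending products represent the cosets of `rhoSubgroup n m`. Right multiplication by `ρ_j`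
lengthens or shortens the product when `j` is at its lower end, and otherwise passes through it into
`u`, as `ρ_j` or `ρ_{j-1}`. -/
theorem exists_mul_descProd {m : ℕ} (hm : m < n) {x : VB n} (hx : x ∈ rhoSubgroup n (m + 1)) :
    ∃ u ∈ rhoSubgroup n m, ∃ k d, k + d = m ∧ x = u * descProd n k d := by
  induction hx using rhoSubgroup_induction with
  | one => exact ⟨1, one_mem _, m, 0, rfl, by simp [descProd]⟩
  | mul_rho x j hj _ hjm ih =>
    obtain ⟨u, hu, k, d, rfl, rfl⟩ := ih
    rw [← rho'_of_lt hj]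
    rcases Nat.lt_trichotomy (j + 1) k with h | rfl | h
    · refine ⟨u * rho j hj, mul_mem hu (rho_mem hj (by omega)), k, d, rfl, ?_⟩
      rw [mul_assoc, (descProd_commute d (Or.inl h)).eq, ← mul_assoc, rho'_of_lt hj]
    · exact ⟨u, hu, j, d + 1, by omega, by rw [descProd_succ_right, mul_assoc]⟩
    rcases Nat.lt_trichotomy j k with h' | rfl | h'
    · omega
    · obtain ⟨e, rfl⟩ : ∃ e, d = e + 1 := ⟨d - 1, by omega⟩
      refine ⟨u, hu, j + 1, e, by omega, ?_⟩
      rw [descProd_succ_right, rho'_of_lt hj, mul_assoc, mul_assoc, rho_mul_self, mul_one]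
    · obtain ⟨i, rfl⟩ : ∃ i, j = i + 1 := ⟨j - 1, by omega⟩
      refine ⟨u * rho i (by omega), mul_mem hu (rho_mem _ (by omega)), k, d, rfl, ?_⟩
      rw [mul_assoc, descProd_mul_rho (by omega) d (by omega) hm, ← mul_assoc, rho'_of_lt]

theorem perm_apply_of_mem {m : ℕ} {x : VB n} (hx : x ∈ rhoSubgroup n m) (a : ℕ) (ha : a < n)
    (hma : m ≤ a) : perm n x ⟨a, ha⟩ = ⟨a, ha⟩ := by
  induction hx using rhoSubgroup_induction with
  | one => simp
  | mul_rho x j hj _ hjm ih =>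
    rw [map_mul, perm_rho, Equiv.Perm.mul_apply, transp_of_ne hj ha (by omega) (by omega), ih]

theorem perm_descProd (k : ℕ) : ∀ d (h : k + d < n),
    perm n (descProd n k d) ⟨k, by omega⟩ = ⟨k + d, h⟩
  | 0, _ => by simp [descProd]
  | d + 1, h => by
    rw [descProd, rho'_of_lt (i := k + d) h, map_mul, Equiv.Perm.mul_apply, perm_descProd k d (by omega),
      perm_rho, transp_left]
    rfl

/-- The `ρ_i` generate a copy of the symmetric group. -/
theorem eq_one_of_perm_eq_one : ∀ m ≤ n, ∀ x ∈ rhoSubgroup n m, perm n x = 1 → x = 1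
  | 0, _, x, hx, _ => by
    have : rhoSubgroup n 0 = ⊥ := by
      rw [rhoSubgroup, Subgroup.closure_eq_bot_iff]
      rintro _ ⟨i, h, hi, -⟩
      omega
    simpa [this] using hx
  | m + 1, hm, x, hx, hp => by
    obtain ⟨u, hu, k, d, rfl, rfl⟩ := exists_mul_descProd hm hx
    -- Follow strand `k`: the descending product takes it to `k + d`, which `u` fixes, so a trivial
    -- permutation forces `d = 0`.
    have h := congrArg (fun π => π ⟨k, by omega⟩) hp
    simp only [map_mul, Equiv.Perm.mul_apply, Equiv.Perm.one_apply] at h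
    rw [perm_descProd k d hm, perm_apply_of_mem hu _ _ le_rfl, Fin.mk.injEq] at h
    obtain rfl : d = 0 := by omega
    simp only [descProd, mul_one] at hp ⊢
    exact eq_one_of_perm_eq_one _ (by omega) u hu hp

theorem exists_rho_perm (π : Equiv.Perm (Fin n)) : ∃ u ∈ rhoSubgroup n n, perm n u = π := by
  obtain _ | n := n
  · exact ⟨1, one_mem _, Subsingleton.elim _ _⟩
  have hπ : π ∈ Submonoid.closure
      (Set.range fun i : Fin n => Equiv.swap i.castSucc i.succ) := by
    rw [Equiv.Perm.mclosure_swap_castSucc_succ]; trivial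
  have hle : Submonoid.closure (Set.range fun i : Fin n => Equiv.swap i.castSucc i.succ) ≤
      ((rhoSubgroup (n + 1) (n + 1)).map (perm (n + 1))).toSubmonoid := by
    rw [Submonoid.closure_le]
    rintro _ ⟨i, rfl⟩
    exact ⟨rho i (by omega), rho_mem _ (by omega), perm_rho _ _⟩
  exact hle hπ

theorem conj_lamE {u : VB n} (hu : u ∈ rhoSubgroup n n) {a b : Fin n} (hab : a ≠ b) :
    u * lamE a b * u⁻¹ = lamE (perm n u a) (perm n u b) := by
  induction hu using rhoSubgroup_induction generalizing a b with
  | one => simp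
  | mul_rho x j hj _ hjm ih =>
    have h : x * rho j hj * lamE a b * (x * rho j hj)⁻¹ =
        x * (rho j hj * lamE a b * rho j hj) * x⁻¹ := by
      rw [mul_inv_rev, rho_inv]; simp only [mul_assoc]
    rw [h, rho_conj_lamE j hj hab, ih ((transp j hj).injective.ne hab), map_mul, perm_rho]
    rfl

/-- The bijection between the two ranges extends to a permutation, which lifts to a product of
`ρ_i`. This moves any configuration of strands into a standard position. -/
theorem exists_conj_lamE {m : ℕ} {f g : Fin m → Fin n} (hf : Function.Injective f)
    (hg : Function.Injective g) : ∃ u ∈ rhoSubgroup n n, (∀ i, perm n u (f i) = g i) ∧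
      ∀ i j, i ≠ j → u * lamE (f i) (f j) * u⁻¹ = lamE (g i) (g j) := by
  let e := ((Equiv.ofInjective f hf).symm.trans (Equiv.ofInjective g hg)).extendSubtype
  have he : ∀ i, e (f i) = g i := fun i => by
    refine (Equiv.extendSubtype_apply_of_mem _ (f i) ⟨i, rfl⟩).trans ?_
    have : (⟨f i, ⟨i, rfl⟩⟩ : Set.range f) = Equiv.ofInjective f hf i := rfl
    simp only [Equiv.trans_apply]
    erw [this]
    simp
  obtain ⟨u, hu, hue⟩ := exists_rho_perm e
  refine ⟨u, hu, fun i => by rw [hue, he], fun i j hij => ?_⟩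
  rw [conj_lamE hu (hf.ne hij), hue, he, he]

end Coxeter

/-! ### The standard relations hold in the virtual pure braid group, and its generators -/

section GroupIdentities

variable {Q : Type*} [Group Q] {a b c p q : Q}

/-- With `a = λ_{10}`, `b = λ_{20}`, `c = λ_{21}`, `p = ρ_0`, `q = ρ_1` one has `a * p = σ_0⁻¹` and
`c * q = σ_1⁻¹`. Moving `p` and `q` to the right reduces the two sides of the braid relation to
triple products times the same element. One direction serves in the virtual braid group, the other
in the semidirect product. -/
theorem triple_iff_braid (h1 : p * c = b * p) (h2 : q * a = b * q) (h3 : p * b = c * p)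
    (h4 : q * b = a * q) (hpq : p * q * p = q * p * q) :
    c * b * a = a * b * c ↔
      a * p * (c * q) * (a * p) = c * q * (a * p) * (c * q) := by
  have e1 : a * p * (c * q) * (a * p) = a * b * c * (p * q * p) :=
    calc a * p * (c * q) * (a * p) = a * (p * c) * (q * a) * p := by group
      _ = a * b * (p * b) * q * p := by rw [h1, h2]; group
      _ = _ := by rw [h3]; group
  have e2 : c * q * (a * p) * (c * q) = c * b * a * (p * q * p) :=
    calc c * q * (a * p) * (c * q) = c * (q * a) * (p * c) * q := by group
      _ = c * b * (q * b) * p * q := by rw [h1, h2]; group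
      _ = c * b * a * (q * p * q) := by rw [h4]; group
      _ = _ := by rw [hpq]
  rw [e1, e2]
  exact ⟨fun h => by rw [h], fun h => (mul_right_cancel h).symm⟩

end GroupIdentities

variable {n : ℕ}

theorem lamE_succ_self (i : ℕ) (h : i + 1 < n) :
    lamE (⟨i + 1, h⟩ : Fin n) ⟨i, by omega⟩ = (sigma i h)⁻¹ * rho i h := lamE_down i 0 h

theorem lamE_self_succ (i : ℕ) (h : i + 1 < n) :
    lamE (⟨i, by omega⟩ : Fin n) ⟨i + 1, h⟩ = rho i h * (sigma i h)⁻¹ := lamE_up i 0 h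

theorem rho_mul_lamE (k : ℕ) (hk : k + 1 < n) {a b : Fin n} (hab : a ≠ b) :
    rho k hk * lamE a b = lamE (transp k hk a) (transp k hk b) * rho k hk :=
  (conj_rho_eq_iff k hk).1 (rho_conj_lamE k hk hab)

theorem lamE_triple_base (h : 2 < n) :
    lamE (⟨2, h⟩ : Fin n) ⟨1, by omega⟩ * lamE ⟨2, h⟩ ⟨0, by omega⟩ *
      lamE (⟨1, by omega⟩ : Fin n) ⟨0, by omega⟩ =
    lamE (⟨1, by omega⟩ : Fin n) ⟨0, by omega⟩ * lamE ⟨2, h⟩ ⟨0, by omega⟩ *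
      lamE (⟨2, h⟩ : Fin n) ⟨1, by omega⟩ := by
  have t0 : transp (n := n) 0 (by omega) ⟨0, by omega⟩ = ⟨1, by omega⟩ := transp_left _ _
  have t1 : transp (n := n) 0 (by omega) ⟨1, by omega⟩ = ⟨0, by omega⟩ := transp_right _
  have t2 : transp (n := n) 0 (by omega) ⟨2, h⟩ = ⟨2, h⟩ :=
    transp_of_ne _ _ (by omega) (by omega)
  have s0 : transp (n := n) 1 h ⟨0, by omega⟩ = ⟨0, by omega⟩ :=
    transp_of_ne _ _ (by omega) (by omega)
  have s1 : transp (n := n) 1 h ⟨1, by omega⟩ = ⟨2, h⟩ := transp_left _ _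
  have s2 : transp (n := n) 1 h ⟨2, h⟩ = ⟨1, by omega⟩ := transp_right _
  refine (triple_iff_braid (p := rho 0 (by omega)) (q := rho 1 h) ?_ ?_ ?_ ?_
    (rho_braid 0 (by omega) h)).2 ?_
  · rw [rho_mul_lamE _ _ (by simp), t2, t1]
  · rw [rho_mul_lamE _ _ (by simp), s1, s0]
  · rw [rho_mul_lamE _ _ (by simp), t2, t0]
  · rw [rho_mul_lamE _ _ (by simp), s2, s0]
  · have e : ∀ (i : ℕ) (hi : i + 1 < n),
        lamE (⟨i + 1, hi⟩ : Fin n) ⟨i, by omega⟩ * rho i hi = (sigma i hi)⁻¹ := fun i hi => by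
      rw [lamE_succ_self, mul_assoc, rho_mul_self, mul_one]
    have e1 := e 0 (by omega)
    have e2 := e 1 h
    simp only [Nat.reduceAdd] at e1 e2
    rw [e1, e2]
    have := congrArg (·⁻¹) (sigma_braid (n := n) 0 (by omega) h)
    simpa only [mul_inv_rev, mul_assoc] using this

theorem lamE_comm_base (h : 3 < n) :
    Commute (lamE (⟨0, by omega⟩ : Fin n) ⟨1, by omega⟩)
      (lamE (⟨2, by omega⟩ : Fin n) ⟨3, h⟩) := by
  have e1 := lamE_self_succ (n := n) 0 (by omega)
  have e2 := lamE_self_succ (n := n) 2 h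
  simp only [Nat.reduceAdd] at e1 e2
  rw [e1, e2]
  exact ((rho_comm _ _ _ _ (by omega)).mul_right
    (sigma_rho_comm _ _ _ _ (by omega)).symm.inv_right).mul_left
    ((sigma_rho_comm _ _ _ _ (by omega)).inv_left.mul_right
      (sigma_comm _ _ _ _ (by omega)).inv_inv)

theorem isPure_lamE (n : ℕ) : IsPure (lamE (n := n)) := by
  refine ⟨fun i j k l h1 h2 h3 h4 h5 h6 => ?_, fun i j k h1 h2 h3 => ?_⟩
  · have hg : Function.Injective ![i, j, k, l] := by
      intro x y; fin_cases x <;> fin_cases y <;> simp_all [eq_comm]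
    have hn : 4 ≤ n := by simpa using Fintype.card_le_of_injective _ hg
    obtain ⟨u, -, -, hu⟩ := exists_conj_lamE (Fin.castLE_injective hn) hg
    have e1 := hu 0 1 (by decide)
    have e2 := hu 2 3 (by decide)
    have hc := lamE_comm_base (n := n) hn
    simp only [Matrix.cons_val] at e1 e2
    rw [← e1, ← e2]
    exact (Commute.conj_iff u).2 hc
  -- The order `j, i, k` matches the strands `0, 1, 2` of `lamE_triple_base`.
  · have hg : Function.Injective ![j, i, k] := by
      intro x y; fin_cases x <;> fin_cases y <;> simp_all [eq_comm]
    have hn : 3 ≤ n := by simpa using Fintype.card_le_of_injective _ hg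
    obtain ⟨u, -, -, hu⟩ := exists_conj_lamE (Fin.castLE_injective hn) hg
    have e1 := hu 2 1 (by decide)
    have e2 := hu 2 0 (by decide)
    have e3 := hu 1 0 (by decide)
    have hc := lamE_triple_base (n := n) hn
    simp only [Matrix.cons_val] at e1 e2 e3
    rw [← e1, ← e2, ← e3]
    simp only [conj_mul]
    exact congrArg (fun x => u * x * u⁻¹) hc

theorem isPure_eval (n : ℕ) : IsPure fun a b => eval n (X a b) := by
  have h := isPure_lamE n
  exact ⟨fun i j k l h1 h2 h3 h4 h5 h6 => Subtype.ext (h.comm i j k l h1 h2 h3 h4 h5 h6).eq,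
    fun i j k h1 h2 h3 => Subtype.ext (h.triple i j k h1 h2 h3)⟩

/-- The set of such products is stable under right multiplication by the generators and their
inverses: `σ_i = λ_{i,i+1}⁻¹ ρ_i`, `σ_i⁻¹ = λ_{i+1,i} ρ_i`, and a letter passes `u` with its indices
permuted. -/
theorem exists_eval_mul_rho (x : VB n) :
    ∃ (w : FreeGroup (Gen n)), ∃ u ∈ rhoSubgroup n n, x = eval n w * u := by
  have hx : x ∈ Subgroup.closure (Set.range (PresentedGroup.of (rels := {r | VBRel n r}))) := by
    rw [PresentedGroup.closure_range_of]; trivial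
  have hrho : ∀ (x : VB n) (i : ℕ) (h : i + 1 < n),
      (∃ (w : FreeGroup (Gen n)), ∃ u ∈ rhoSubgroup n n, x = eval n w * u) →
      ∃ (w : FreeGroup (Gen n)), ∃ u ∈ rhoSubgroup n n, x * rho i h = eval n w * u := by
    rintro _ i h ⟨w, u, hu, rfl⟩
    exact ⟨w, u * rho i h, mul_mem hu (rho_mem h h), mul_assoc _ _ _⟩
  have hlam : ∀ (x : VB n) (a b : Fin n), a ≠ b → ∀ z : ℤ,
      (∃ (w : FreeGroup (Gen n)), ∃ u ∈ rhoSubgroup n n, x = eval n w * u) →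
      ∃ (w : FreeGroup (Gen n)), ∃ u ∈ rhoSubgroup n n, x * lamE a b ^ z = eval n w * u := by
    rintro _ a b hab z ⟨w, u, hu, rfl⟩
    refine ⟨w * X (perm n u a) (perm n u b) ^ z, u, hu, ?_⟩
    have := conj_lamE hu hab
    rw [map_mul, map_zpow, Subgroup.coe_mul, Subgroup.coe_zpow]
    change _ = _ * lamE (perm n u a) (perm n u b) ^ z * u
    rw [← this, conj_zpow]
    group
  induction hx using Subgroup.closure_induction_right with
  | one => exact ⟨1, 1, one_mem _, by simp⟩
  | mul_right x hx y hy ih =>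
    obtain ⟨g, rfl⟩ := hy
    cases g with
    | sigma i h =>
      have := hrho _ i h (hlam x ⟨i, by omega⟩ ⟨i + 1, h⟩ (by simp) (-1) ih)
      rw [lamE_self_succ, zpow_neg_one, mul_inv_rev, inv_inv, mul_assoc, mul_assoc,
        inv_mul_cancel, mul_one] at this
      exact this
    | rho i h => exact hrho x i h ih
  | mul_inv_cancel x hx y hy ih =>
    obtain ⟨g, rfl⟩ := hy
    cases g with
    | sigma i h =>
      have := hrho _ i h (hlam x ⟨i + 1, h⟩ ⟨i, by omega⟩ (by simp) 1 ih)
      rw [lamE_succ_self, zpow_one, mul_assoc, mul_assoc, rho_mul_self, mul_one] at this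
      exact this
    | rho i h =>
      change ∃ (w : FreeGroup (Gen n)), ∃ u ∈ rhoSubgroup n n, x * (rho i h)⁻¹ = eval n w * u
      rw [rho_inv]; exact hrho x i h ih

/-- In the decomposition of a pure element the factor `u` has trivial permutation, hence is trivial.
-/
theorem eval_surjective (n : ℕ) : Function.Surjective (eval n) := by
  rintro ⟨x, hx⟩
  obtain ⟨w, u, hu, rfl⟩ := exists_eval_mul_rho x
  rw [MonoidHom.mem_ker, map_mul, MonoidHom.mem_ker.1 (eval n w).2, one_mul] at hx
  exact ⟨w, Subtype.ext (by simp [eq_one_of_perm_eq_one n le_rfl u hu hx])⟩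

/-! ### Completeness of the standard relations, through a semidirect product -/

/-- The group presented by the standard relations. -/
abbrev PureGroup (n : ℕ) : Type := PresentedGroup (RV n)

/-- The generator `λ_{a,b}` of the presented group, for `a ≠ b`. -/
def gen {n : ℕ} (a b : Fin n) : PureGroup n := PresentedGroup.mk (RV n) (X a b)

theorem isPure_gen (n : ℕ) : IsPure (gen (n := n)) :=
  (isPure_iff (PresentedGroup.mk (RV n))).1 fun _ hr => PresentedGroup.one_of_mem hr

theorem lift_X {Q : Type*} [Group Q] (F : Fin n → Fin n → Q) {a b : Fin n} (h : a ≠ b) :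
    FreeGroup.lift (fun g : Gen n => F g.1.1 g.1.2) (X a b) = F a b := by
  simp [X, h]

/-- The homomorphism defined by a family satisfying the standard relations. -/
def IsPure.lift {Q : Type*} [Group Q] {F : Fin n → Fin n → Q} (h : IsPure F) :
    PureGroup n →* Q :=
  PresentedGroup.toGroup (f := fun g : Gen n => F g.1.1 g.1.2) <|
    (isPure_iff _).2 (h.congr fun _ _ hab => (lift_X F hab).symm)

theorem IsPure.lift_gen {Q : Type*} [Group Q] {F : Fin n → Fin n → Q} (h : IsPure F)
    {a b : Fin n} (hab : a ≠ b) : h.lift (gen a b) = F a b :=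
  lift_X F hab

theorem PureGroup.hom_ext {Q : Type*} [Group Q] {f g : PureGroup n →* Q}
    (h : ∀ a b, a ≠ b → f (gen a b) = g (gen a b)) : f = g := by
  refine PresentedGroup.ext fun x => ?_
  have := h x.1.1 x.1.2 x.2
  simpa [gen, X, x.2, PresentedGroup.of] using this

/-- The action of a permutation of the strands. -/
def permHom (π : Equiv.Perm (Fin n)) : PureGroup n →* PureGroup n :=
  ((isPure_gen n).comp π π.injective).lift

theorem permHom_gen (π : Equiv.Perm (Fin n)) {a b : Fin n} (h : a ≠ b) :
    permHom π (gen a b) = gen (π a) (π b) := IsPure.lift_gen _ h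

theorem permHom_one : permHom (1 : Equiv.Perm (Fin n)) = MonoidHom.id _ :=
  PureGroup.hom_ext fun a b h => by simp [permHom_gen _ h]

theorem permHom_mul (π τ : Equiv.Perm (Fin n)) :
    permHom (π * τ) = (permHom π).comp (permHom τ) :=
  PureGroup.hom_ext fun a b h => by
    simp [permHom_gen _ h, permHom_gen _ (τ.injective.ne h)]

/-- The action of the symmetric group on the presented group. -/
def permAut (n : ℕ) : Equiv.Perm (Fin n) →* MulAut (PureGroup n) where
  toFun π := MonoidHom.toMulEquiv (permHom π) (permHom π⁻¹)
    (by rw [← permHom_mul, inv_mul_cancel, permHom_one])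
    (by rw [← permHom_mul, mul_inv_cancel, permHom_one])
  map_one' := by ext x; simp [permHom_one]
  map_mul' π τ := by ext x; simp [permHom_mul]

/-- The semidirect product of the presented group with the symmetric group. -/
abbrev PureSemi (n : ℕ) : Type := PureGroup n ⋊[permAut n] Equiv.Perm (Fin n)

open SemidirectProduct in
theorem inr_mul_inl_gen (π : Equiv.Perm (Fin n)) {a b : Fin n} (h : a ≠ b) :
    (inr π * inl (gen a b) : PureSemi n) = inl (gen (π a) (π b)) * inr π := by
  have : gen (π a) (π b) = permAut n π (gen a b) := (permHom_gen π h).symm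
  rw [this, inl_aut, map_inv, inv_mul_cancel_right]

open SemidirectProduct in
/-- The image of `σ_i⁻¹` in the semidirect product. -/
def semiSigmaInv (i : ℕ) (h : i + 1 < n) : PureSemi n :=
  inl (gen ⟨i + 1, h⟩ ⟨i, by omega⟩) * inr (transp i h)

open SemidirectProduct in
/-- The map to the semidirect product on generators. -/
def semiGen : VBGen n → PureSemi n
  | .sigma i h => (semiSigmaInv i h)⁻¹
  | .rho i h => inr (transp i h)

open SemidirectProduct in
-- The image of `σ_i⁻¹` copies the identity `σ_i⁻¹ = λ_{i+1,i} ρ_i`; the braid relation then comes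
-- from the triple relation, and the mixed ones from the action on indices.
theorem semiGen_rel : ∀ r ∈ {r : FreeGroup (VBGen n) | VBRel n r},
    FreeGroup.lift semiGen r = 1 := by
  have hcomm : ∀ (i j : ℕ) (hi : i + 1 < n) (hj : j + 1 < n), (i + 1 < j ∨ j + 1 < i) →
      Commute (semiSigmaInv i hi) (inr (transp j hj)) := by
    intro i j hi hj hij
    refine Commute.mul_left (Commute.symm ?_) ?_
    · rw [commute_iff_eq, inr_mul_inl_gen _ (by simp), transp_of_ne _ _ (by omega) (by omega),
        transp_of_ne _ _ (by omega) (by omega)]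
    · rw [commute_iff_eq, ← map_mul, ← map_mul]
      rcases hij with hij | hij
      · rw [transp_comm i j hi hj hij]
      · rw [transp_comm j i hj hi hij]
  rintro r hr
  cases hr with
  | sigma_comm i j hi hj hij =>
    rw [map_mul, map_inv, mul_inv_eq_one]
    simp only [fsigma, map_mul, FreeGroup.lift_apply_of, semiGen]
    have h1 : Commute (inl (gen ⟨i + 1, hi⟩ ⟨i, by omega⟩) : PureSemi n)
        (inl (gen ⟨j + 1, hj⟩ ⟨j, by omega⟩)) :=
      ((isPure_gen n).comm _ _ _ _ (by simp) (by simp; omega) (by simp; omega) (by simp; omega)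
        (by simp; omega) (by simp)).map inl
    have h2 : Commute (inr (transp i hi) : PureSemi n) (inl (gen ⟨j + 1, hj⟩ ⟨j, by omega⟩)) := by
      rw [commute_iff_eq, inr_mul_inl_gen _ (by simp), transp_of_ne _ _ (by omega) (by omega),
        transp_of_ne _ _ (by omega) (by omega)]
    have h3 : Commute (semiSigmaInv i hi) (semiSigmaInv j hj) :=
      (h1.mul_left h2).mul_right (hcomm i j hi hj (Or.inl hij))
    exact h3.inv_inv.eq
  | sigma_braid i hi hi' =>
    rw [map_mul, map_inv, mul_inv_eq_one]
    simp only [fsigma, map_mul, FreeGroup.lift_apply_of, semiGen]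
    have h1 : semiSigmaInv i hi * semiSigmaInv (i + 1) hi' * semiSigmaInv i hi =
        semiSigmaInv (i + 1) hi' * semiSigmaInv i hi * semiSigmaInv (i + 1) hi' := by
      refine (triple_iff_braid
        (b := (inl (gen ⟨i + 1 + 1, hi'⟩ ⟨i, by omega⟩) : PureSemi n)) ?_ ?_ ?_ ?_ ?_).1 ?_
      · rw [inr_mul_inl_gen _ (by simp), transp_of_ne _ _ (by omega) (by omega), transp_right]
      · rw [inr_mul_inl_gen _ (by simp), transp_left, transp_of_ne _ _ (by omega) (by omega)]
      · rw [inr_mul_inl_gen _ (by simp; omega), transp_of_ne _ _ (by omega) (by omega),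
          transp_left]
      · rw [inr_mul_inl_gen _ (by simp; omega), transp_right,
          transp_of_ne _ _ (by omega) (by omega)]
      · simp only [← map_mul, transp_braid i hi hi']
      · simp only [← map_mul]
        rw [(isPure_gen n).triple _ _ _ (by simp) (by simp) (by simp; omega)]
    have := congrArg (·⁻¹) h1
    simpa only [mul_inv_rev, mul_assoc] using this
  | rho_sq i hi =>
    simp only [frho, map_mul, FreeGroup.lift_apply_of, semiGen]
    rw [← map_mul, transp, Equiv.swap_mul_self, map_one]
  | rho_comm i j hi hj hij =>
    rw [map_mul, map_inv, mul_inv_eq_one]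
    simp only [frho, map_mul, FreeGroup.lift_apply_of, semiGen]
    rw [← map_mul, transp_comm i j hi hj hij, map_mul]
  | rho_braid i hi hi' =>
    rw [map_mul, map_inv, mul_inv_eq_one]
    simp only [frho, map_mul, FreeGroup.lift_apply_of, semiGen]
    simp only [← map_mul, transp_braid i hi hi']
  | mixed_comm i j hi hj hij =>
    rw [map_mul, map_inv, mul_inv_eq_one]
    simp only [fsigma, frho, map_mul, FreeGroup.lift_apply_of, semiGen]
    exact (hcomm i j hi hj hij).inv_left.eq
  | mixed i hi hi' =>
    rw [map_mul, map_inv, mul_inv_eq_one]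
    simp only [fsigma, frho, map_mul, FreeGroup.lift_apply_of, semiGen]
    have h1 : semiSigmaInv (i + 1) hi' * (inr (transp i hi) * inr (transp (i + 1) hi')) =
        inr (transp i hi) * inr (transp (i + 1) hi') * semiSigmaInv i hi := by
      rw [semiSigmaInv, semiSigmaInv, ← mul_assoc (inr _ * inr _),
        mul_assoc (inr (transp i hi)) _ (inl _), inr_mul_inl_gen _ (by simp), transp_left,
        transp_of_ne _ _ (by omega) (by omega), ← mul_assoc (inr (transp i hi)),
        inr_mul_inl_gen _ (by simp; omega), transp_of_ne _ _ (by omega) (by omega), transp_left]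
      simp only [mul_assoc, ← map_mul]
      simp only [← mul_assoc, transp_braid i hi hi']
    rw [mul_inv_eq_iff_eq_mul, mul_assoc, mul_assoc, eq_inv_mul_iff_mul_eq, h1,
      mul_assoc]

/-- The map from the virtual braid group to the semidirect product. -/
def toSemi (n : ℕ) : VB n →* PureSemi n := PresentedGroup.toGroup semiGen_rel

open SemidirectProduct in
theorem toSemi_of_mem {u : VB n} (hu : u ∈ rhoSubgroup n n) : toSemi n u = inr (perm n u) := by
  induction hu using rhoSubgroup_induction with
  | one => simp
  | mul_rho x j hj _ _ ih =>
    rw [map_mul, map_mul, map_mul, ih, perm_rho]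
    rfl

open SemidirectProduct in
-- Computed directly for `λ_{10}`, then transported by conjugation with a product of `ρ_i`, which
-- acts on both sides by permuting indices.
theorem toSemi_lamE {a b : Fin n} (hab : a ≠ b) : toSemi n (lamE a b) = inl (gen a b) := by
  have hg : Function.Injective ![b, a] := by
    intro x y; fin_cases x <;> fin_cases y <;> simp_all [eq_comm]
  have hn : 2 ≤ n := by simpa using Fintype.card_le_of_injective _ hg
  obtain ⟨u, hu, hp, hc⟩ := exists_conj_lamE (Fin.castLE_injective hn) hg
  have e := hc 1 0 (by decide)
  have hp0 := hp 0
  have hp1 := hp 1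
  simp only [Matrix.cons_val] at e hp0 hp1
  have hbase : toSemi n (lamE (Fin.castLE hn 1) (Fin.castLE hn 0)) =
      inl (gen (Fin.castLE hn 1) (Fin.castLE hn 0)) := by
    have h0 : lamE (Fin.castLE hn 1) (Fin.castLE hn 0) = (sigma 0 hn)⁻¹ * rho 0 hn :=
      lamE_succ_self 0 hn
    rw [h0, map_mul, map_inv]
    have h1 : toSemi n (sigma 0 hn) = (semiSigmaInv 0 hn)⁻¹ := rfl
    have h2 : toSemi n (rho 0 hn) = inr (transp 0 hn) := rfl
    rw [h1, h2, inv_inv, semiSigmaInv, mul_assoc, ← map_mul, transp, Equiv.swap_mul_self, map_one,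
      mul_one]
    rfl
  rw [← e, map_mul, map_mul, map_inv, hbase, toSemi_of_mem hu,
    inr_mul_inl_gen _ ((Fin.castLE_injective hn).ne (by decide)), mul_inv_cancel_right, hp0, hp1]

open SemidirectProduct in
theorem toSemi_eval (w : FreeGroup (Gen n)) :
    toSemi n (eval n w) = inl (PresentedGroup.mk (RV n) w) := by
  have : ((toSemi n).comp (VP n).subtype).comp (eval n) =
      (inl : PureGroup n →* PureSemi n).comp (PresentedGroup.mk (RV n)) := by
    refine FreeGroup.ext_hom _ _ fun g => ?_
    have := toSemi_lamE g.2
    simpa [lamE, gen, X, g.2] using this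
  exact DFunLike.congr_fun this w

/-- The standard relations define the virtual pure braid group. -/
theorem eval_eq_one_iff {w : FreeGroup (Gen n)} :
    eval n w = 1 ↔ w ∈ Subgroup.normalClosure (RV n) := by
  constructor
  · intro h
    -- A word of trivial value has trivial image in the semidirect product, into which the presented
    -- group embeds.
    have := toSemi_eval w
    rw [h, OneMemClass.coe_one, map_one, eq_comm, map_eq_one_iff _ SemidirectProduct.inl_injective,
      PresentedGroup.mk_eq_one_iff] at this
    exact this
  · intro h
    exact Subgroup.normalClosure_le_normal (N := (eval n).ker)
      (fun r hr => (isPure_iff _).2 (isPure_eval n) r hr) h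

/-! ### Adding and forgetting the last strand -/

theorem addStrand_lamUp (i : ℕ) : ∀ (d : ℕ) (h : i + d + 1 < n),
    addStrand n (lamUp i d h) = lamUp i d (by omega)
  | 0, h => by simp [lamUp, addStrand, rho, sigma, addStrandGen]
  | d + 1, h => by
    rw [lamUp, map_mul, map_mul, addStrand_lamUp i d, lamUp]
    simp [addStrand, rho, addStrandGen]

theorem addStrand_lamDown (i : ℕ) : ∀ (d : ℕ) (h : i + d + 1 < n),
    addStrand n (lamDown i d h) = lamDown i d (by omega)
  | 0, h => by simp [lamDown, addStrand, rho, sigma, addStrandGen]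
  | d + 1, h => by
    rw [lamDown, map_mul, map_mul, addStrand_lamDown i d, lamDown]
    simp [addStrand, rho, addStrandGen]

theorem addStrand_lamE {a b : Fin n} (hab : a ≠ b) :
    addStrand n (lamE a b) = lamE a.castSucc b.castSucc := by
  obtain ⟨a, ha⟩ := a
  obtain ⟨b, hb⟩ := b
  rcases lt_or_gt_of_ne (show a ≠ b by simpa using hab) with h | h
  · obtain ⟨d, rfl⟩ : ∃ d, b = a + d + 1 := ⟨b - a - 1, by omega⟩
    rw [lamE_up, addStrand_lamUp]
    exact (lamE_up a d _).symm
  · obtain ⟨d, rfl⟩ : ∃ d, a = b + d + 1 := ⟨a - b - 1, by omega⟩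
    rw [lamE_down, addStrand_lamDown]
    exact (lamE_down b d _).symm

theorem inclWord_X {a b : Fin n} (hab : a ≠ b) :
    inclWord n (X a b) = X a.castSucc b.castSucc := by
  simp [inclWord, X, hab]

theorem addStrand_eval (w : FreeGroup (Gen n)) :
    addStrand n (eval n w) = eval (n + 1) (inclWord n w) := by
  have : ((addStrand n).comp (VP n).subtype).comp (eval n) =
      ((VP (n + 1)).subtype.comp (eval (n + 1))).comp (inclWord n) := by
    refine FreeGroup.ext_hom _ _ fun g => ?_
    have h1 := addStrand_lamE g.2
    have h2 : FreeGroup.of g = X g.1.1 g.1.2 := by simp [X, g.2]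
    simp only [MonoidHom.comp_apply, h2, inclWord_X g.2]
    exact h1
  exact DFunLike.congr_fun this w

/-- The homomorphism of virtual pure braid groups adding a trivial last strand. -/
def addStrandPure (n : ℕ) : VP n →* VP (n + 1) :=
  ((addStrand n).comp (VP n).subtype).codRestrict (VP (n + 1)) fun β => by
    obtain ⟨w, rfl⟩ := eval_surjective n β
    rw [MonoidHom.comp_apply, Subgroup.subtype_apply, addStrand_eval]
    exact (eval (n + 1) _).2

theorem addStrandPure_eval (w : FreeGroup (Gen n)) :
    addStrandPure n (eval n w) = eval (n + 1) (inclWord n w) :=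
  Subtype.ext (addStrand_eval w)

/-- Words on `n + 1` strands with the last strand forgotten. -/
def forgetWord (n : ℕ) : FreeGroup (Gen (n + 1)) →* FreeGroup (Gen n) :=
  FreeGroup.lift fun g =>
    if h : g.1.1 ≠ Fin.last n ∧ g.1.2 ≠ Fin.last n then X (g.1.1.castPred h.1) (g.1.2.castPred h.2)
    else 1

theorem forgetWord_X {a b : Fin n} (hab : a ≠ b) :
    forgetWord n (X a.castSucc b.castSucc) = X a b := by
  simp [forgetWord, X, hab, Fin.castSucc_ne_last]

theorem forgetWord_last_left (b : Fin (n + 1)) : forgetWord n (X (Fin.last n) b) = 1 := by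
  by_cases h : Fin.last n = b <;> simp [forgetWord, X, h]

theorem forgetWord_last_right (a : Fin (n + 1)) : forgetWord n (X a (Fin.last n)) = 1 := by
  by_cases h : a = Fin.last n <;> simp [forgetWord, X, h]

/-- If the last strand occurs in a relation, deleting its letters leaves the same single letter on
both sides. -/
theorem isPure_forgetWord {Q : Type*} [Group Q] {f : FreeGroup (Gen n) →* Q}
    (h : IsPure fun a b => f (X a b)) : IsPure fun a b => f (forgetWord n (X a b)) := by
  refine ⟨fun i j k l h1 h2 h3 h4 h5 h6 => ?_, fun i j k h1 h2 h3 => ?_⟩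
  · rcases Fin.eq_castSucc_or_eq_last i with ⟨i, rfl⟩ | rfl
    swap; · simp [forgetWord_last_left]
    rcases Fin.eq_castSucc_or_eq_last j with ⟨j, rfl⟩ | rfl
    swap; · simp [forgetWord_last_right]
    rcases Fin.eq_castSucc_or_eq_last k with ⟨k, rfl⟩ | rfl
    swap; · simp [forgetWord_last_left]
    rcases Fin.eq_castSucc_or_eq_last l with ⟨l, rfl⟩ | rfl
    swap; · simp [forgetWord_last_right]
    simp only [ne_eq, Fin.castSucc_inj] at *
    rw [forgetWord_X h1, forgetWord_X h6]
    exact h.comm i j k l h1 h2 h3 h4 h5 h6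
  · rcases Fin.eq_castSucc_or_eq_last i with ⟨i, rfl⟩ | rfl
    swap; · simp [forgetWord_last_left, forgetWord_last_right]
    rcases Fin.eq_castSucc_or_eq_last j with ⟨j, rfl⟩ | rfl
    swap; · simp [forgetWord_last_right]
    rcases Fin.eq_castSucc_or_eq_last k with ⟨k, rfl⟩ | rfl
    swap; · simp [forgetWord_last_left]
    simp only [ne_eq, Fin.castSucc_inj] at *
    rw [forgetWord_X h1, forgetWord_X (Ne.symm h2), forgetWord_X (Ne.symm h3)]
    exact h.triple i j k h1 h2 h3

theorem forgetWord_inclWord (w : FreeGroup (Gen n)) : forgetWord n (inclWord n w) = w := by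
  have : (forgetWord n).comp (inclWord n) = MonoidHom.id _ := by
    refine FreeGroup.ext_hom _ _ fun g => ?_
    have h2 : FreeGroup.of g = X g.1.1 g.1.2 := by simp [X, g.2]
    simp only [MonoidHom.comp_apply, h2, inclWord_X g.2, forgetWord_X g.2, MonoidHom.id_apply]
  exact DFunLike.congr_fun this w

/-- A homomorphism killing the standard relators kills every trivial word. -/
theorem map_eq_one_of_eval_eq_one {Q : Type*} [Group Q] {f : FreeGroup (Gen n) →* Q}
    (h : IsPure fun a b => f (X a b)) {w : FreeGroup (Gen n)} (hw : eval n w = 1) : f w = 1 :=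
  Subgroup.normalClosure_le_normal (N := f.ker) (fun r hr => (isPure_iff f).2 h r hr)
    (eval_eq_one_iff.1 hw)

/-- Forgetting the last strand undoes the inclusion on words, and it sends words of trivial value to
words of trivial value because the standard relations are complete. -/
theorem addStrandPure_injective (n : ℕ) : Function.Injective (addStrandPure n) := by
  rw [injective_iff_map_eq_one]
  intro β hβ
  obtain ⟨w, rfl⟩ := eval_surjective n β
  rw [addStrandPure_eval] at hβ
  have := map_eq_one_of_eval_eq_one (f := (eval n).comp (forgetWord n))
    (isPure_forgetWord (isPure_eval n)) hβ
  rwa [MonoidHom.comp_apply, forgetWord_inclWord] at this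

/-! ### Degeneracies as homomorphisms, and the cabling presentation -/

/-- Existence: `s_t` respects the standard relations, which generate the kernel of evaluation.
Uniqueness: evaluation is surjective. -/
theorem existsUnique_degeneracy (t : Fin n) : ∃! s : VP n →* VP (n + 1),
    ∀ w : FreeGroup (Gen n), s (eval n w) = eval (n + 1) (degWord t w) := by
  have hker : (eval n).ker ≤ ((eval (n + 1)).comp (degWord t)).ker := fun w hw =>
    map_eq_one_of_eval_eq_one (f := (eval (n + 1)).comp (degWord t))
      ((isPure_eval (n + 1)).degWord t) hw
  refine ⟨(eval n).liftOfSurjective (eval_surjective n) ⟨_, hker⟩, fun w => ?_, fun s hs => ?_⟩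
  · exact MonoidHom.liftOfRightInverse_comp_apply _ _ _ ⟨_, hker⟩ w
  · ext β : 1
    obtain ⟨w, rfl⟩ := eval_surjective n β
    rw [hs]
    exact (MonoidHom.liftOfRightInverse_comp_apply _ _ _ ⟨_, hker⟩ w).symm

theorem eval_eq_one_of_mem_cablingRels {r : FreeGroup (Gen (n + 1))} (hr : r ∈ cablingRels n) :
    eval (n + 1) r = 1 := by
  have h := isPure_eval (n + 1)
  rcases hr with ⟨r, hr, rfl⟩ | hr
  · refine (isPure_iff ((eval (n + 1)).comp (inclWord n))).2 ?_ r hr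
    refine (h.comp _ (Fin.castSucc_injective n)).congr fun a b hab => ?_
    rw [MonoidHom.comp_apply, inclWord_X hab]
  · obtain ⟨t, r, hr', rfl⟩ := Set.mem_iUnion.1 hr
    exact (isPure_iff ((eval (n + 1)).comp (degWord t))).2 (h.degWord t) r hr'

theorem isPure_mk_cablingRels (hn : 4 ≤ n) :
    IsPure fun a b => PresentedGroup.mk (cablingRels n) (X a b) := by
  refine isPure_of_degWord hn _ ?_ fun t => ?_
  · refine ((isPure_iff ((PresentedGroup.mk (cablingRels n)).comp (inclWord n))).1 fun r hr =>
      PresentedGroup.one_of_mem (Or.inl ⟨r, hr, rfl⟩)).congr fun a b hab => ?_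
    rw [MonoidHom.comp_apply, inclWord_X hab]
  · exact (isPure_iff ((PresentedGroup.mk (cablingRels n)).comp (degWord t))).1 fun r hr =>
      PresentedGroup.one_of_mem (Or.inr (Set.mem_iUnion.2 ⟨t, r, hr, rfl⟩))

/-- The homomorphism from the group presented by the cabling relations. -/
def cablingHom (n : ℕ) : PresentedGroup (cablingRels n) →* VP (n + 1) :=
  PresentedGroup.toGroup (f := lam) fun _ hr => eval_eq_one_of_mem_cablingRels hr

theorem cablingHom_mk (w : FreeGroup (Gen (n + 1))) :
    cablingHom n (PresentedGroup.mk _ w) = eval (n + 1) w := rfl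

theorem cablingHom_of (g : Gen (n + 1)) : cablingHom n (PresentedGroup.of g) = lam g :=
  PresentedGroup.toGroup.of _

/-- A word of trivial value is a consequence of the standard relations on `n + 1` strands, and these
already hold in the group presented by the cabling relators. -/
theorem cablingHom_bijective (hn : 4 ≤ n) : Function.Bijective (cablingHom n) := by
  constructor
  · rw [injective_iff_map_eq_one]
    intro x hx
    obtain ⟨w, rfl⟩ := PresentedGroup.mk_surjective _ x
    exact map_eq_one_of_eval_eq_one (isPure_mk_cablingRels hn) (by rwa [cablingHom_mk] at hx)
  · intro β
    obtain ⟨w, rfl⟩ := eval_surjective (n + 1) β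
    exact ⟨PresentedGroup.mk _ w, cablingHom_mk w⟩

end VirtualBraid

open VirtualBraid in
theorem mainTheorem3 (n : ℕ) (hn : 4 ≤ n) :
    (∃ ι : VP n →* VP (n + 1), Function.Injective ι ∧
      (∀ β : VP n, (ι β : VB (n + 1)) = addStrand n β) ∧
      ∀ w : FreeGroup (Gen n), ι (eval n w) = eval (n + 1) (inclWord n w)) ∧
    (∀ t : Fin n, ∃! s : VP n →* VP (n + 1),
      ∀ w : FreeGroup (Gen n), s (eval n w) = eval (n + 1) (degWord t w)) ∧
    ∃ e : PresentedGroup (cablingRels n) ≃* VP (n + 1),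
      ∀ g : Gen (n + 1), e (PresentedGroup.of g) = lam g := by
  exact ⟨⟨addStrandPure n, addStrandPure_injective n, fun _ => rfl, addStrandPure_eval⟩,
    existsUnique_degeneracy, MulEquiv.ofBijective (cablingHom n) (cablingHom_bijective hn),
    cablingHom_of⟩
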